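/- **Theorem 5.** Let $q\ge 1$, let $\|\cdot\|$ be the Euclidean norm on $\mathbb{R}^q$ and the induced operator norm on $\mathbb{R}^{q\times q}$, and consider on a probability space the recursion $$e(t+1)=e(t)+\alpha(t)\big(Q(t)+\Delta(t)\big)e(t)+\alpha(t)\big(\varepsilon'(t)+\varepsilon''(t)\big),\qquad t=0,1,2,\dots,$$ with deterministic step sizes $\alpha(t)\in\mathbb{R}$, random matrices $Q(t),\Delta(t)\in\mathbb{R}^{q\times q}$, random vectors $\varepsilon'(t),\varepsilon''(t)\in\mathbb{R}^q$, and a fixed (deterministic) initial value $e(0)\in\mathbb{R}^q$. Let $\mathcal{F}(t)=\sigma(Q(s),\Delta(s),\varepsilon'(s),\,0\le s\le t)$ and $\mathcal{F}(-1)=\{\emptyset,\Omega\}$. Assume: (i) $\alpha(t)>0$ for all $t$, $\alpha(t)\to0$, $\sum_{t=1}^\infty\alpha(t)=\infty$, and $\frac1{\alpha(t+1)}-\frac1{\alpha(t)}\to\alpha_0$ for some $\alpha_0\ge0$. (ii.a) There is a constant $\pi_1>0$ with $\sup_{t}\|Q(t)\|\le\pi_1$ a.s., and there are an integer $h\ge1$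 and $\lambda>0$ such that for every $m=0,1,2,\dots$ $$\lambda_{\max}\Big[\sum_{t=mh}^{(m+1)h-1}\mathbb{E}\{Q(t)+Q^{\mathsf T}(t)\mid\mathcal{F}(mh-1)\}\Big]\le-\lambda\quad\text{a.s.,}$$ where $\lambda_{\max}$ denotes the largest eigenvalue. (ii.b) $\|\Delta(t)\|\le g_1(t)$ a.s. for all $t$, where $g_1:[0,\infty)\to(0,\infty)$ is a bounded measurable function with $g_1(t)\to0$ as $t\to\infty$. (iii.a) $\mathbb{E}\{\varepsilon'(t)\mid\mathcal{F}(t-1)\}=0$ for all $t$ (so $\varepsilon'$ is a martingale difference sequence), and there are $\delta\in[0,1/2)$ and a constant $c_\varepsilon>0$ such that $\sup_t\mathbb{E}\{\|\alpha(t)^\delta\varepsilon'(t)\|^2\mid\mathcal{F}(t-1)\}\le c_\varepsilon$ a.s. (iii.b) $\varepsilon''(t)$ is $\mathcal{F}(t)$-measurable and $\|\varepsilon''(t)\|\le g_2(t)$ a.s. for all $t$, where $g_2:[0,\infty)\to(0,\infty)$ is a bounded measurable function with $g_2(t)\to0$ as $t\to\infty$. Then $\lim_{t\to\infty}\mathbb{E}\{\|e(t)\|^2\}=0$.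 If in addition (a) $\sum_{t=1}^\infty\alpha(t)^{2(1-\delta)}<\infty$, with $\delta$ as in (iii.a), (b) $\sum_{t=1}^\infty\alpha(t)g_2(t)<\infty$, and (c) $\varepsilon'(t)=u(t)w(t)$ for all $t$, with random $u(t)\in\mathbb{R}^{q\times q}$ and $w(t)\in\mathbb{R}^q$ such that $\{w(t)\}_{t\ge0}$ is independent of $\{(Q(t),\Delta(t),u(t))\}_{t\ge0}$, and each $w(t)$ is integrable with $\mathbb{E}\{w(t)\mid\mathcal{F}(t-1)\}=0$, then $\mathbb{P}\{\lim_{t\to\infty}e(t)=0\}=1$. -/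

import Mathlib

open MeasureTheory ProbabilityTheory Filter Topology
open scoped Matrix Matrix.Norms.L2Operator NNReal

/-- Random matrices are measured entrywise (the product, i.e. Borel, σ-algebra on matrices). -/
instance matrixMeasurableSpace {q : ℕ} : MeasurableSpace (Matrix (Fin q) (Fin q) ℝ) :=
  inferInstanceAs (MeasurableSpace (Fin q → Fin q → ℝ))

/-- `history Q Δ ε t` is the σ-algebra `ℱ(t - 1) = σ(Q(s), Δ(s), ε(s), 0 ≤ s ≤ t - 1)` generated by
everything strictly before time `t`; in particular `history Q Δ ε 0` is the trivial σ-algebra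
`ℱ(-1) = {∅, Ω}` and `history Q Δ ε (t + 1)` is `ℱ(t)`. -/
@[reducible] def history {Ω : Type*} {q : ℕ} (Q Δ : ℕ → Ω → Matrix (Fin q) (Fin q) ℝ)
    (ε : ℕ → Ω → EuclideanSpace ℝ (Fin q)) (t : ℕ) : MeasurableSpace Ω :=
  ⨆ s ∈ Finset.range t,
    MeasurableSpace.comap (Q s) inferInstance ⊔
      (MeasurableSpace.comap (Δ s) inferInstance ⊔ MeasurableSpace.comap (ε s) inferInstance)

/-- The largest eigenvalue of a real symmetric matrix. -/
noncomputable def lambdaMax {q : ℕ} (A : Matrix (Fin q) (Fin q) ℝ) : ℝ :=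
  sSup (spectrum ℝ A)

/-! Negative definiteness of `Q` is available only after averaging over a window of `h` steps and
conditioning on its start, so ‖e‖² serves as a Lyapunov function sampled at the times `m * h`. With
x the state at a block start and a the step there, ‖e‖² is expanded over the block around x. The
drift a Σ 2⟨x, Q x⟩ has conditional mean at most -λ a ‖x‖², the linear noise term has conditional
mean zero, and every error is either a small multiple of a ‖x‖² or of the form α² ‖ε'‖² + α g₂
(`exists_block_norm_sq_le`). Half of the drift survives, so `exists_eventually_setIntegral_block_le`
gives, over each event of the past, V(m+1) ≤ (1 - (λ/2) a) V(m) + b(m), with b a block sum of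
α^(2(1-δ)) and α g₂.

This one inequality yields both modes of convergence. On the whole space, b = o(a) because δ < 1/2,
and Σ a diverges because steps within a block are asymptotically equal; hence the means at block
starts vanish (`tendsto_zero_of_le_one_sub_mul_add`). Over arbitrary past events, when b is
summable, it makes ‖e‖² a supermartingale up to summable errors; martingale convergence gives an
almost sure limit, and the mean identifies it as zero (`ae_tendsto_zero_of_almost_supermartingale`).
Crude one-step bounds then fill in the times between block starts. -/

/-! ### Deterministic recursions and step sizes -/

/-- A nonnegative sequence with `v (m + 1) ≤ (1 - c a m) v m + b m`, where the steps `a` are small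
but not summable and `b` is negligible with respect to `a`, tends to zero. -/
theorem tendsto_zero_of_le_one_sub_mul_add {v a b : ℕ → ℝ} {c : ℝ} (hc : 0 < c)
    (hv : ∀ m, 0 ≤ v m) (ha_zero : Tendsto a atTop (𝓝 0))
    (ha_sum : Tendsto (fun M => ∑ m ∈ Finset.range M, a m) atTop atTop)
    (hb : ∀ κ > 0, ∀ᶠ m in atTop, b m ≤ κ * a m)
    (hrec : ∀ᶠ m in atTop, v (m + 1) ≤ (1 - c * a m) * v m + b m) :
    Tendsto v atTop (𝓝 0) := by
  have key : ∀ r > 0, ∀ᶠ m in atTop, v m ≤ 2 * r := by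
    intro r hr
    have h1 : ∀ᶠ m in atTop, c * a m ≤ 1 := by
      have : Tendsto (fun m => c * a m) atTop (𝓝 0) := by simpa using ha_zero.const_mul c
      exact this.eventually_le_const one_pos
    -- With b ≤ c r a the level r is preserved by the recursion, so v - r contracts by 1 - c a ≤
    -- exp(-c a); divergence of Σ a then forces decay below r.
    obtain ⟨M, hM⟩ := eventually_atTop.1 ((h1.and (hb (c * r) (by positivity))).and hrec)
    set A : ℕ → ℝ := fun k => ∑ m ∈ Finset.range k, a m
    have hind : ∀ k, M ≤ k → v k - r ≤ Real.exp (-c * (A k - A M)) * v M := by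
      intro k hk
      induction k, hk using Nat.le_induction with
      | base => simp; linarith [hr]
      | succ k hk ih =>
        obtain ⟨⟨h1, h2⟩, h3⟩ := hM k hk
        have e1 : v (k + 1) - r ≤ (1 - c * a k) * (v k - r) := by nlinarith
        have e2 : 1 - c * a k ≤ Real.exp (-(c * a k)) := by
          linarith [Real.add_one_le_exp (-(c * a k))]
        have e3 : A (k + 1) = A k + a k := Finset.sum_range_succ _ _
        calc v (k + 1) - r ≤ (1 - c * a k) * (v k - r) := e1
          _ ≤ (1 - c * a k) * (Real.exp (-c * (A k - A M)) * v M) :=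
              mul_le_mul_of_nonneg_left ih (by linarith)
          _ ≤ Real.exp (-(c * a k)) * (Real.exp (-c * (A k - A M)) * v M) :=
              mul_le_mul_of_nonneg_right e2 (mul_nonneg (Real.exp_pos _).le (hv M))
          _ = Real.exp (-c * (A (k + 1) - A M)) * v M := by
              rw [← mul_assoc, ← Real.exp_add, e3]; congr 2; ring
    have hlim : Tendsto (fun k => Real.exp (-c * (A k - A M)) * v M) atTop (𝓝 0) := by
      have h2 : Tendsto (fun k => c * (A k - A M)) atTop atTop :=
        (tendsto_atTop_add_const_right _ (-A M) ha_sum).const_mul_atTop hc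
      have h3 := (Real.tendsto_exp_neg_atTop_nhds_zero.comp h2).mul_const (v M)
      simpa [Function.comp_def] using h3
    filter_upwards [hlim.eventually_le_const hr, eventually_ge_atTop M] with k hk hk'
    linarith [hind k hk']
  rw [Metric.tendsto_nhds]
  intro r hr
  filter_upwards [key (r / 4) (by positivity)] with m hm
  rw [Real.dist_eq, sub_zero, abs_of_nonneg (hv m)]
  linarith

/-- A nonnegative sequence with `f (t + 1) ≤ C f t + r t` and `r → 0` tends to zero as soon as it
does so along the multiples of `h`. -/
theorem tendsto_zero_of_tendsto_multiples {f r : ℕ → ℝ} {C : ℝ} {h : ℕ} (hh : 0 < h)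
    (hf : ∀ t, 0 ≤ f t) (hr : Tendsto r atTop (𝓝 0))
    (hrec : ∀ t, f (t + 1) ≤ C * f t + r t)
    (hmul : Tendsto (fun m => f (m * h)) atTop (𝓝 0)) : Tendsto f atTop (𝓝 0) := by
  have hmh : Tendsto (fun m : ℕ => m * h) atTop atTop :=
    tendsto_id.atTop_mul_const' hh
  -- Induction on the offset within a block; only the finitely many offsets j < h are needed, so
  -- their limits combine into one.
  have hres : ∀ j, Tendsto (fun m => f (m * h + j)) atTop (𝓝 0) := by
    intro j
    induction j with
    | zero => simpa using hmul
    | succ j ih =>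
      refine squeeze_zero (fun m => hf _) (fun m => hrec (m * h + j)) ?_
      have h2 : Tendsto (fun m => r (m * h + j)) atTop (𝓝 0) :=
        hr.comp (tendsto_atTop_mono (fun m => Nat.le_add_right _ j) hmh)
      simpa using (ih.const_mul C).add h2
  rw [Metric.tendsto_atTop]
  intro κ hκ
  have hev : ∀ᶠ m in atTop, ∀ j ∈ Finset.range h, dist (f (m * h + j)) 0 < κ := by
    rw [Filter.eventually_all_finset]
    intro j _
    exact (Metric.tendsto_nhds.1 (hres j)) κ hκ
  obtain ⟨M, hM⟩ := eventually_atTop.1 hev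
  refine ⟨M * h, fun t ht => ?_⟩
  have := hM (t / h) ((Nat.le_div_iff_mul_le hh).2 ht) (t % h)
    (Finset.mem_range.2 (Nat.mod_lt _ hh))
  rwa [mul_comm, Nat.div_add_mod] at this

/-- Step sizes whose inverses have a convergent increment are asymptotically constant over
windows of bounded length. -/
theorem eventually_abs_sub_le_of_inv_increment {α : ℕ → ℝ} {α₀ : ℝ} (hα_pos : ∀ t, 0 < α t)
    (hα_zero : Tendsto α atTop (𝓝 0))
    (hα_inv : Tendsto (fun t => 1 / α (t + 1) - 1 / α t) atTop (𝓝 α₀))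
    (h : ℕ) {κ : ℝ} (hκ : 0 < κ) :
    ∀ᶠ t in atTop, ∀ j < h, |α (t + j) - α t| ≤ κ * α t := by
  -- The ratio is 1 + α t (1 / α (t + 1) - 1 / α t): a null sequence times a convergent one is added
  -- to 1.
  have h1 : Tendsto (fun t => α t / α (t + 1)) atTop (𝓝 1) := by
    have := (hα_zero.mul hα_inv).add_const 1
    simp only [zero_mul, zero_add] at this
    refine this.congr fun t => ?_
    have := (hα_pos t).ne'
    have := (hα_pos (t + 1)).ne'
    field_simp
    ring
  have h2 : Tendsto (fun t => α (t + 1) / α t) atTop (𝓝 1) := by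
    have := h1.inv₀ one_ne_zero
    simpa using this
  have h3 : ∀ j, Tendsto (fun t => α (t + j) / α t) atTop (𝓝 1) := by
    intro j
    induction j with
    | zero => simp [div_self (hα_pos _).ne']
    | succ j ih =>
      have := (h2.comp (tendsto_add_atTop_nat j)).mul ih
      rw [one_mul] at this
      refine this.congr fun t => ?_
      have := (hα_pos t).ne'
      have := (hα_pos (t + j)).ne'
      simp only [Function.comp, add_assoc]
      field_simp
  have h4 : ∀ᶠ t in atTop, ∀ j ∈ Finset.range h, dist (α (t + j) / α t) 1 < κ := by
    rw [Filter.eventually_all_finset]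
    exact fun j _ => Metric.tendsto_nhds.1 (h3 j) κ hκ
  filter_upwards [h4] with t ht j hj
  have h5 := (ht j (Finset.mem_range.2 hj)).le
  have hp := hα_pos t
  rw [Real.dist_eq, show α (t + j) / α t - 1 = (α (t + j) - α t) / α t by field_simp, abs_div,
    abs_of_pos hp, div_le_iff₀ hp] at h5
  exact h5

theorem sum_range_mul_eq_sum_blocks (f : ℕ → ℝ) (h M : ℕ) :
    ∑ t ∈ Finset.range (M * h), f t
      = ∑ m ∈ Finset.range M, ∑ j ∈ Finset.range h, f (m * h + j) := by
  induction M with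
  | zero => simp
  | succ M ih => rw [Finset.sum_range_succ, ← ih, add_mul, one_mul, Finset.sum_range_add]

/-- If consecutive terms within blocks of length `h` are comparable, divergence of a positive series
passes to the subseries of block starts. -/
theorem tendsto_sum_multiples_atTop {α : ℕ → ℝ} (hα_pos : ∀ t, 0 < α t)
    (hα_sum : Tendsto (fun n : ℕ => ∑ t ∈ Finset.Icc 1 n, α t) atTop atTop) {h : ℕ} (hh : 0 < h)
    (hcomp : ∀ᶠ t in atTop, ∀ j < h, α (t + j) ≤ 2 * α t) :
    Tendsto (fun M => ∑ m ∈ Finset.range M, α (m * h)) atTop atTop := by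
  rw [← not_summable_iff_tendsto_nat_atTop_of_nonneg (fun m => (hα_pos _).le)]
  intro hs
  have hblock : Summable fun m => ∑ j ∈ Finset.range h, α (m * h + j) := by
    refine summable_of_isBigO_nat hs (Asymptotics.IsBigO.of_bound (h * 2) ?_)
    have hmh : Tendsto (fun m : ℕ => m * h) atTop atTop := tendsto_id.atTop_mul_const' hh
    filter_upwards [hmh.eventually hcomp] with m hm
    rw [Real.norm_of_nonneg (Finset.sum_nonneg fun j _ => (hα_pos _).le),
      Real.norm_of_nonneg (hα_pos _).le]
    calc _ ≤ ∑ j ∈ Finset.range h, 2 * α (m * h) :=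
          Finset.sum_le_sum fun j hj => hm j (Finset.mem_range.1 hj)
      _ = _ := by simp [mul_assoc]
  have hsum : Summable α := by
    refine summable_of_sum_range_le (c := ∑' m, ∑ j ∈ Finset.range h, α (m * h + j))
      (fun t => (hα_pos t).le) fun n => ?_
    calc ∑ t ∈ Finset.range n, α t ≤ ∑ t ∈ Finset.range (n * h), α t :=
          Finset.sum_le_sum_of_subset_of_nonneg
            (Finset.range_mono (Nat.le_mul_of_pos_right n hh)) fun t _ _ => (hα_pos t).le
      _ = _ := sum_range_mul_eq_sum_blocks α h n
      _ ≤ _ := hblock.sum_le_tsum _ fun m _ => Finset.sum_nonneg fun j _ => (hα_pos _).le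
  obtain ⟨n, hn⟩ := (hα_sum.eventually_gt_atTop (∑' t, α t)).exists
  exact absurd (hsum.sum_le_tsum (Finset.Icc 1 n) fun t _ => (hα_pos t).le) (not_le.2 hn)

theorem Summable.sum_blocks {f : ℕ → ℝ} (hf : Summable f) {h : ℕ} (hh : 0 < h) :
    Summable fun m => ∑ j ∈ Finset.range h, f (m * h + j) := by
  refine summable_sum fun j _ => hf.comp_injective (i := fun m => m * h + j) fun m m' hm => ?_
  exact Nat.eq_of_mul_eq_mul_right hh (Nat.add_right_cancel hm)

/-! ### Pathwise expansion over one block -/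

/-- Discrete Grönwall argument: splitting ‖y j‖ ≤ ‖y j - y 0‖ + ‖y 0‖ makes the deviation grow by a
factor at most 1 + A K per step, with a source that involves only the initial state and the noise.
-/
theorem norm_sub_le_of_norm_increment_le {E : Type*} [SeminormedAddCommGroup E] {y : ℕ → E} {α n : ℕ → ℝ} {A K : ℝ} {h : ℕ}
    (hK : 0 ≤ K) (hα : ∀ j < h, 0 ≤ α j) (hA : ∀ j < h, α j ≤ A) (hn : ∀ j < h, 0 ≤ n j)
    (hy : ∀ j < h, ‖y (j + 1) - y j‖ ≤ α j * K * ‖y j‖ + n j) :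
    ∀ j ≤ h, ‖y j - y 0‖ ≤ (1 + A * K) ^ h * ∑ i ∈ Finset.range h, (α i * K * ‖y 0‖ + n i) := by
  rcases Nat.eq_zero_or_pos h with rfl | hpos
  · intro j hj
    obtain rfl : j = 0 := by omega
    simp
  have hA0 : 0 ≤ A := (hα 0 hpos).trans (hA 0 hpos)
  have hAK : 1 ≤ 1 + A * K := by nlinarith
  have hterm : ∀ i < h, 0 ≤ α i * K * ‖y 0‖ + n i := fun i hi => by
    have := hα i hi; have := hn i hi; positivity
  have hind : ∀ j ≤ h, ‖y j - y 0‖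
      ≤ (1 + A * K) ^ j * ∑ i ∈ Finset.range j, (α i * K * ‖y 0‖ + n i) := by
    intro j
    induction j with
    | zero => simp
    | succ j ih =>
      intro hj
      have hj' : j < h := by omega
      have ih := ih hj'.le
      have h1 := hy j hj'
      have h2 : ‖y j‖ ≤ ‖y j - y 0‖ + ‖y 0‖ := by
        simpa using norm_add_le (y j - y 0) (y 0)
      have h3 : ‖y (j + 1) - y 0‖ ≤ ‖y (j + 1) - y j‖ + ‖y j - y 0‖ := by
        simpa using norm_add_le (y (j + 1) - y j) (y j - y 0)
      have h4 : α j * K * ‖y j‖ ≤ α j * K * (‖y j - y 0‖ + ‖y 0‖) :=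
        mul_le_mul_of_nonneg_left h2 (mul_nonneg (hα j hj') hK)
      have h5 : α j * K * ‖y j - y 0‖ ≤ A * K * ‖y j - y 0‖ := by
        have := hA j hj'; gcongr
      have h6 := hterm j hj'
      have h7 : 1 ≤ (1 + A * K) ^ (j + 1) := one_le_pow₀ hAK
      rw [Finset.sum_range_succ]
      calc ‖y (j + 1) - y 0‖ ≤ (1 + A * K) * ‖y j - y 0‖ + (α j * K * ‖y 0‖ + n j) := by
            linarith
        _ ≤ (1 + A * K) * ((1 + A * K) ^ j * ∑ i ∈ Finset.range j, (α i * K * ‖y 0‖ + n i))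
            + (1 + A * K) ^ (j + 1) * (α j * K * ‖y 0‖ + n j) := by
            gcongr
            exact le_mul_of_one_le_left h6 h7
        _ = _ := by ring
  intro j hj
  refine (hind j hj).trans ?_
  have h8 : ∑ i ∈ Finset.range j, (α i * K * ‖y 0‖ + n i)
      ≤ ∑ i ∈ Finset.range h, (α i * K * ‖y 0‖ + n i) :=
    Finset.sum_le_sum_of_subset_of_nonneg (Finset.range_mono hj)
      fun i hi _ => hterm i (Finset.mem_range.1 hi)
  have h9 : 0 ≤ ∑ i ∈ Finset.range j, (α i * K * ‖y 0‖ + n i) :=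
    Finset.sum_nonneg fun i hi => hterm i (lt_of_lt_of_le (Finset.mem_range.1 hi) hj)
  exact mul_le_mul (pow_le_pow_right₀ hAK hj) h8 h9 (by positivity)

set_option maxHeartbeats 1000000 in
/-- Expansion of the squared norm over a block of `h` steps around the state at its start. The
constant `C` does not depend on the size `κ` of the perturbations. -/
theorem exists_block_norm_sq_le {E : Type*} [NormedAddCommGroup E] [InnerProductSpace ℝ E] (π₁ : ℝ) (hπ₁ : 0 < π₁) (h : ℕ) :
    ∃ C > 0, ∀ (y : ℕ → E) (Q D : ℕ → E →ₗ[ℝ] E) (ε' ε'' : ℕ → E) (α g : ℕ → ℝ) (a κ : ℝ),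
      κ ≤ 1 → 0 < a → a ≤ κ → (∀ j < h, 0 < α j) → (∀ j < h, |α j - a| ≤ κ * a) →
      (∀ j < h, 0 ≤ g j) → (∀ j < h, g j ≤ κ) → (∀ j < h, ‖ε'' j‖ ≤ g j) →
      (∀ j < h, ∀ v, ‖Q j v‖ ≤ π₁ * ‖v‖) → (∀ j < h, ∀ v, ‖D j v‖ ≤ κ * ‖v‖) →
      (∀ j < h, y (j + 1) = y j + α j • (Q j (y j) + D j (y j)) + α j • (ε' j + ε'' j)) →
      ‖y h‖ ^ 2 ≤ ‖y 0‖ ^ 2 + a * ∑ j ∈ Finset.range h, 2 * inner ℝ (y 0) (Q j (y 0))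
        + ∑ j ∈ Finset.range h, 2 * α j * inner ℝ (y 0) (ε' j)
        + C * κ * a * ‖y 0‖ ^ 2
        + C * ∑ j ∈ Finset.range h, (α j ^ 2 * ‖ε' j‖ ^ 2 + α j * g j) := by
  -- K bounds Q + D since κ ≤ 1; P is the Grönwall constant for h steps of size at most 2; C
  -- collects the coefficients produced by `hstep`, `hlast` and `hN2`.
  obtain ⟨K, hKdef⟩ : ∃ K, K = π₁ + 1 := ⟨_, rfl⟩
  have hK : 0 < K := by rw [hKdef]; positivity
  obtain ⟨P, hP⟩ : ∃ P, P = (1 + 2 * K) ^ h * (2 * h * K + 1) := ⟨_, rfl⟩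
  have hP0 : 0 < P := by rw [hP]; positivity
  obtain ⟨C, hC⟩ : ∃ C : ℝ, C = 2 * h * π₁ + 6 * h + 8 * h * K * P + 2 * P ^ 2
    + (8 * h * K * P + 2 * P ^ 2) * (4 * h) + 1 := ⟨_, rfl⟩
  refine ⟨C, by rw [hC]; positivity, ?_⟩
  intro y Q D ε' ε'' α g a κ hκ1 ha haκ hα hαa hg hgκ hε'' hQ hD hy
  have hκ : 0 < κ := ha.trans_le haκ
  have hα2a : ∀ j < h, α j ≤ 2 * a := fun j hj => by
    have := (abs_le.1 (hαa j hj)).2; nlinarith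
  have hα2 : ∀ j < h, α j ≤ 2 := fun j hj => by
    have := hα2a j hj; linarith
  set x := y 0 with hx
  set N := ∑ i ∈ Finset.range h, α i * (‖ε' i‖ + g i) with hN
  have hN0 : 0 ≤ N := Finset.sum_nonneg fun i hi => by
    have hi := Finset.mem_range.1 hi
    exact mul_nonneg (hα i hi).le (add_nonneg (norm_nonneg _) (hg i hi))
  have hM : ∀ j < h, ∀ v, ‖Q j v + D j v‖ ≤ K * ‖v‖ := fun j hj v => by
    have h1 := norm_add_le (Q j v) (D j v)
    have h2 := hQ j hj v
    have h3 := hD j hj v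
    have h4 : κ * ‖v‖ ≤ 1 * ‖v‖ := by gcongr
    rw [hKdef, add_mul]; linarith
  have hdev : ∀ j ≤ h, ‖y j - x‖ ≤ P * (a * ‖x‖ + N) := by
    intro j hj
    have h1 := norm_sub_le_of_norm_increment_le (y := y) (α := α)
      (n := fun i => α i * (‖ε' i‖ + g i)) (A := 2) hK.le (fun j hj => (hα j hj).le) hα2
      (fun i hi => mul_nonneg (hα i hi).le (add_nonneg (norm_nonneg _) (hg i hi)))
      (fun i hi => by
        rw [hy i hi, show y i + α i • (Q i (y i) + D i (y i)) + α i • (ε' i + ε'' i) - y i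
          = α i • (Q i (y i) + D i (y i)) + α i • (ε' i + ε'' i) by abel]
        have hαi := (hα i hi).le
        refine (norm_add_le _ _).trans ?_
        rw [norm_smul, norm_smul, Real.norm_of_nonneg hαi, mul_assoc]
        gcongr
        · exact hM i hi _
        · exact (norm_add_le _ _).trans (by have := hε'' i hi; gcongr)) j hj
    refine h1.trans ?_
    rw [hP, mul_assoc]
    gcongr
    rw [Finset.sum_add_distrib, ← hN, ← Finset.sum_mul, ← Finset.sum_mul]
    have h2 : ∑ i ∈ Finset.range h, α i ≤ h * (2 * a) := by
      calc _ ≤ ∑ i ∈ Finset.range h, 2 * a :=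
            Finset.sum_le_sum fun i hi => hα2a i (Finset.mem_range.1 hi)
        _ = _ := by simp
    have h3 : (∑ i ∈ Finset.range h, α i) * K * ‖x‖ ≤ h * (2 * a) * K * ‖x‖ := by gcongr
    have h4 : 0 ≤ 2 * h * K * N := by positivity
    have h5 : 0 ≤ a * ‖x‖ := by positivity
    rw [← hx]
    nlinarith
  -- R controls all second-order products. Its part a² ‖x‖² is at most κ a ‖x‖² because a ≤ κ, and
  -- N² is returned to the noise sum by `hN2`.
  obtain ⟨R, hR⟩ : ∃ R, R = a ^ 2 * ‖x‖ ^ 2 + N ^ 2 := ⟨_, rfl⟩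
  have hx0 := norm_nonneg x
  have hcross : a * ‖x‖ * (a * ‖x‖ + N) ≤ 2 * R := by
    rw [hR]; nlinarith [sq_nonneg (a * ‖x‖ - N), sq_nonneg N]
  have hsq : (a * ‖x‖ + N) ^ 2 ≤ 2 * R := by
    rw [hR]; nlinarith [sq_nonneg (a * ‖x‖ - N)]
  have hyh : y h - x = ∑ j ∈ Finset.range h, (y (j + 1) - y j) := (Finset.sum_range_sub y h).symm
  have hexp : ‖y h‖ ^ 2 = ‖x‖ ^ 2 + ∑ j ∈ Finset.range h, 2 * inner ℝ x (y (j + 1) - y j)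
      + ‖y h - x‖ ^ 2 := by
    rw [← Finset.mul_sum, ← inner_sum, ← hyh]
    conv_lhs => rw [← add_sub_cancel x (y h), norm_add_sq_real]
  have hstep : ∀ j ∈ Finset.range h, 2 * inner ℝ x (y (j + 1) - y j)
      ≤ a * (2 * inner ℝ x (Q j x)) + 2 * α j * inner ℝ x (ε' j)
        + ((2 * π₁ + 6) * κ * a * ‖x‖ ^ 2 + 8 * K * P * R) + α j * g j := by
    intro j hj
    have hj := Finset.mem_range.1 hj
    have hαj := hα j hj
    have e0 : y (j + 1) - y j = α j • Q j x + α j • D j x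
        + α j • (Q j (y j - x) + D j (y j - x)) + α j • ε' j + α j • ε'' j := by
      rw [hy j hj, map_sub, map_sub]; module
    have i1 : inner ℝ x (y (j + 1) - y j) = α j * inner ℝ x (Q j x) + α j * inner ℝ x (D j x)
        + α j * inner ℝ x (Q j (y j - x) + D j (y j - x)) + α j * inner ℝ x (ε' j)
        + α j * inner ℝ x (ε'' j) := by
      rw [e0]; simp only [inner_add_right, inner_smul_right]
    have b1 : (α j - a) * inner ℝ x (Q j x) ≤ κ * a * (π₁ * ‖x‖ ^ 2) := by
      refine (le_abs_self _).trans ?_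
      rw [abs_mul]
      refine mul_le_mul (hαa j hj) ?_ (abs_nonneg _) (by positivity)
      refine (abs_real_inner_le_norm _ _).trans ?_
      have := mul_le_mul_of_nonneg_left (hQ j hj x) hx0
      linarith
    have b2 : α j * inner ℝ x (D j x) ≤ 2 * a * (κ * ‖x‖ ^ 2) := by
      have h1 : inner ℝ x (D j x) ≤ κ * ‖x‖ ^ 2 := by
        refine (real_inner_le_norm _ _).trans ?_
        have := mul_le_mul_of_nonneg_left (hD j hj x) hx0
        linarith
      refine (mul_le_mul_of_nonneg_left h1 hαj.le).trans ?_
      have := hα2a j hj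
      gcongr
    have b3 : α j * inner ℝ x (Q j (y j - x) + D j (y j - x)) ≤ 4 * K * P * R := by
      have h1 : inner ℝ x (Q j (y j - x) + D j (y j - x))
          ≤ ‖x‖ * (K * (P * (a * ‖x‖ + N))) := by
        refine (real_inner_le_norm _ _).trans ?_
        gcongr
        refine (hM j hj _).trans ?_
        gcongr
        exact hdev j hj.le
      calc _ ≤ α j * (‖x‖ * (K * (P * (a * ‖x‖ + N)))) := mul_le_mul_of_nonneg_left h1 hαj.le
        _ ≤ 2 * a * (‖x‖ * (K * (P * (a * ‖x‖ + N)))) := by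
            have := hα2a j hj
            gcongr
        _ = 2 * K * P * (a * ‖x‖ * (a * ‖x‖ + N)) := by ring
        _ ≤ 2 * K * P * (2 * R) := by gcongr
        _ = _ := by ring
    -- The term linear in ‖x‖ is split by 2‖x‖ ≤ 1 + ‖x‖²: one part is the remainder α g, the other
    -- is absorbed by the drift since g ≤ κ.
    have b4 : 2 * (α j * inner ℝ x (ε'' j)) ≤ α j * g j + 2 * a * κ * ‖x‖ ^ 2 := by
      have h1 : inner ℝ x (ε'' j) ≤ ‖x‖ * g j :=
        (real_inner_le_norm _ _).trans (mul_le_mul_of_nonneg_left (hε'' j hj) hx0)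
      have h2 : 2 * ‖x‖ ≤ 1 + ‖x‖ ^ 2 := by nlinarith [sq_nonneg (‖x‖ - 1)]
      have h3 : α j * g j ≤ 2 * a * κ :=
        mul_le_mul (hα2a j hj) (hgκ j hj) (hg j hj) (by positivity)
      have h4 : 0 ≤ α j * g j := mul_nonneg hαj.le (hg j hj)
      calc 2 * (α j * inner ℝ x (ε'' j)) ≤ 2 * (α j * (‖x‖ * g j)) := by gcongr
        _ = α j * g j * (2 * ‖x‖) := by ring
        _ ≤ α j * g j * (1 + ‖x‖ ^ 2) := by gcongr
        _ = α j * g j + α j * g j * ‖x‖ ^ 2 := by ring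
        _ ≤ _ := by gcongr
    rw [i1]
    nlinarith
  -- Since α ≤ 2 and g ≤ 1, α² g² ≤ 2 α g, so g enters the remainder only to first order.
  have hN2 : N ^ 2 ≤ 4 * h * ∑ j ∈ Finset.range h, (α j ^ 2 * ‖ε' j‖ ^ 2 + α j * g j) := by
    have h1 := sq_sum_le_card_mul_sum_sq (s := Finset.range h)
      (f := fun i => α i * (‖ε' i‖ + g i))
    rw [Finset.card_range] at h1
    refine h1.trans ?_
    rw [mul_comm (4 : ℝ), mul_assoc, Finset.mul_sum _ _ (4 : ℝ)]
    gcongr with j hj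
    have hj := Finset.mem_range.1 hj
    have g1 : g j ≤ 1 := (hgκ j hj).trans hκ1
    have g2 : (α j * g j) * (α j * g j) ≤ (α j * g j) * 2 := by
      have := mul_le_mul (hα2 j hj) g1 (hg j hj) zero_le_two
      exact mul_le_mul_of_nonneg_left (by linarith) (mul_nonneg (hα j hj).le (hg j hj))
    nlinarith [sq_nonneg (α j * ‖ε' j‖ - α j * g j), sq_nonneg (α j * ‖ε' j‖)]
  set S := ∑ j ∈ Finset.range h, (α j ^ 2 * ‖ε' j‖ ^ 2 + α j * g j) with hS
  have hg_sum : ∑ j ∈ Finset.range h, α j * g j ≤ S := by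
    rw [hS]; gcongr with j hj
    have : 0 ≤ α j ^ 2 * ‖ε' j‖ ^ 2 := by positivity
    linarith
  have hR' : R ≤ κ * a * ‖x‖ ^ 2 + 4 * h * S := by
    have : a ^ 2 * ‖x‖ ^ 2 ≤ κ * a * ‖x‖ ^ 2 := by
      rw [sq a]; gcongr
    rw [hR]; linarith
  have hlast : ‖y h - x‖ ^ 2 ≤ 2 * P ^ 2 * R := by
    calc _ ≤ (P * (a * ‖x‖ + N)) ^ 2 := by gcongr; exact hdev h le_rfl
      _ = P ^ 2 * (a * ‖x‖ + N) ^ 2 := by ring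
      _ ≤ P ^ 2 * (2 * R) := by gcongr
      _ = _ := by ring
  have hsteps := Finset.sum_le_sum hstep
  simp only [Finset.sum_add_distrib, Finset.sum_const, Finset.card_range, nsmul_eq_mul,
    ← Finset.mul_sum _ _ a] at hsteps
  have hS0 : 0 ≤ S := Finset.sum_nonneg fun j hj => by
    have hj := Finset.mem_range.1 hj
    have := hα j hj; have := hg j hj; positivity
  have hfin : (8 * h * K * P + 2 * P ^ 2) * R
      ≤ (8 * h * K * P + 2 * P ^ 2) * (κ * a * ‖x‖ ^ 2 + 4 * h * S) := by gcongr
  have hz : 0 ≤ κ * a * ‖x‖ ^ 2 := by positivity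
  have hR0 : 0 ≤ R := by rw [hR]; positivity
  rw [hexp]
  have e1 : C * κ * a * ‖x‖ ^ 2 = (2 * h * π₁ + 6 * h) * (κ * a * ‖x‖ ^ 2)
      + (8 * h * K * P + 2 * P ^ 2) * (κ * a * ‖x‖ ^ 2)
      + ((8 * h * K * P + 2 * P ^ 2) * (4 * h) + 1) * (κ * a * ‖x‖ ^ 2) := by rw [hC]; ring
  have e2 : C * S = (2 * h * π₁ + 6 * h + 8 * h * K * P + 2 * P ^ 2) * S
      + (8 * h * K * P + 2 * P ^ 2) * (4 * h) * S + S := by rw [hC]; ring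
  have p1 : 0 ≤ ((8 * h * K * P + 2 * P ^ 2) * (4 * h) + 1) * (κ * a * ‖x‖ ^ 2) := by positivity
  have p2 : 0 ≤ (2 * h * π₁ + 6 * h + 8 * h * K * P + 2 * P ^ 2) * S := by positivity
  rw [e1, e2]
  linarith

/-! ### Matrices as operators and Rayleigh's bound -/

section LinearAlgebra

variable {q : ℕ}

/-- Square matrices as continuous operators on Euclidean space, as a continuous linear map. -/
noncomputable def matrixToCLM (q : ℕ) : Matrix (Fin q) (Fin q) ℝ →L[ℝ]
    (EuclideanSpace ℝ (Fin q) →L[ℝ] EuclideanSpace ℝ (Fin q)) :=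
  LinearMap.toContinuousLinearMap
    (Matrix.toEuclideanLin ≪≫ₗ LinearMap.toContinuousLinearMap).toLinearMap

theorem matrixToCLM_apply (A : Matrix (Fin q) (Fin q) ℝ) (x : EuclideanSpace ℝ (Fin q)) :
    matrixToCLM q A x = Matrix.toEuclideanLin A x := rfl

theorem continuous_toEuclideanLin :
    Continuous fun p : Matrix (Fin q) (Fin q) ℝ × EuclideanSpace ℝ (Fin q) =>
      Matrix.toEuclideanLin p.1 p.2 :=
  ((matrixToCLM q).continuous.comp continuous_fst).clm_apply continuous_snd

theorem Measurable.stronglyMeasurable_matrix {Ω : Type*} {m : MeasurableSpace Ω}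
    {A : Ω → Matrix (Fin q) (Fin q) ℝ} (hA : Measurable A) : StronglyMeasurable A :=
  Measurable.stronglyMeasurable (β := Fin q → Fin q → ℝ) hA

theorem measurable_toEuclideanLin {Ω : Type*} {m : MeasurableSpace Ω}
    {A : Ω → Matrix (Fin q) (Fin q) ℝ} {x : Ω → EuclideanSpace ℝ (Fin q)} (hA : Measurable A)
    (hx : Measurable x) : Measurable fun ω => Matrix.toEuclideanLin (A ω) (x ω) :=
  (continuous_toEuclideanLin.comp_stronglyMeasurable
    (hA.stronglyMeasurable_matrix.prodMk hx.stronglyMeasurable)).measurable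

theorem norm_toEuclideanLin_le (A : Matrix (Fin q) (Fin q) ℝ) (x : EuclideanSpace ℝ (Fin q)) :
    ‖Matrix.toEuclideanLin A x‖ ≤ ‖A‖ * ‖x‖ :=
  (matrixToCLM q A).le_opNorm x

/-- The transpose is the adjoint and the real inner product is symmetric. Hence the form of Q + Qᵀ
is twice that of Q, which links the eigenvalue hypothesis to the drift. -/
theorem inner_toEuclideanLin_transpose (A : Matrix (Fin q) (Fin q) ℝ)
    (x : EuclideanSpace ℝ (Fin q)) :
    inner ℝ x (Matrix.toEuclideanLin Aᵀ x) = inner ℝ x (Matrix.toEuclideanLin A x) := by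
  rw [← Matrix.conjTranspose_eq_transpose_of_trivial,
    Matrix.toEuclideanLin_conjTranspose_eq_adjoint, LinearMap.adjoint_inner_right]
  exact real_inner_comm (F := EuclideanSpace ℝ (Fin q)) _ _

open scoped MatrixOrder in
/-- Rayleigh's bound by the largest eigenvalue. -/
theorem inner_toEuclideanLin_le_lambdaMax {A : Matrix (Fin q) (Fin q) ℝ} (hA : Aᵀ = A)
    (x : EuclideanSpace ℝ (Fin q)) :
    inner ℝ x (Matrix.toEuclideanLin A x) ≤ lambdaMax A * ‖x‖ ^ 2 := by
  have hA' : A.IsHermitian := by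
    rwa [Matrix.IsHermitian, Matrix.conjTranspose_eq_transpose_of_trivial]
  have hbdd : BddAbove (spectrum ℝ A) := (Matrix.finite_real_spectrum (A := A)).bddAbove
  -- The spectrum of `lambdaMax A` - A is the reflected spectrum of A, nonnegative because the
  -- supremum bounds a finite set. For q = 0 the spectrum is empty and there is nothing to check.
  have hpos : (algebraMap ℝ (Matrix (Fin q) (Fin q) ℝ) (lambdaMax A) - A).PosSemidef := by
    rw [Matrix.posSemidef_iff_isHermitian_and_spectrum_nonneg]
    constructor
    · refine Matrix.IsHermitian.sub ?_ hA'
      rw [Algebra.algebraMap_eq_smul_one]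
      simp [Matrix.IsHermitian]
    · rw [← spectrum.singleton_sub_eq]
      rintro r hr
      obtain ⟨s, rfl, t, ht, rfl⟩ := Set.mem_sub.1 hr
      exact sub_nonneg.2 (le_csSup hbdd ht)
  have h1 := hpos.dotProduct_mulVec_nonneg x.ofLp
  have h2 : 0 ≤ inner ℝ x (Matrix.toEuclideanLin
      (algebraMap ℝ (Matrix (Fin q) (Fin q) ℝ) (lambdaMax A) - A) x) := by
    rw [real_inner_comm]
    exact h1
  have h3 : inner ℝ x (Matrix.toEuclideanLin (1 : Matrix (Fin q) (Fin q) ℝ) x) = ‖x‖ ^ 2 := by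
    rw [← real_inner_self_eq_norm_sq]
    simp
  rw [map_sub, Algebra.algebraMap_eq_smul_one, map_smul, LinearMap.sub_apply, inner_sub_right,
    LinearMap.smul_apply, inner_smul_right, h3] at h2
  linarith

end LinearAlgebra

/-! ### Conditional expectations of quadratic forms -/

section CondExp

variable {Ω : Type*} {m₀ : MeasurableSpace Ω} {μ : Measure Ω}

theorem MeasureTheory.MemLp.integrable_real_inner {E : Type*} [NormedAddCommGroup E]
    [InnerProductSpace ℝ E] {x y : Ω → E} (hx : MemLp x 2 μ) (hy : MemLp y 2 μ) :
    Integrable (fun ω => inner ℝ (x ω) (y ω)) μ :=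
  Integrable.mono' (hx.norm.integrable_mul hy.norm)
    (hx.aestronglyMeasurable.inner hy.aestronglyMeasurable)
    (ae_of_all _ fun _ => norm_inner_le_norm _ _)

/-- Pulling the arguments of a quadratic form out of a conditional expectation. -/
theorem condExp_inner_clm_apply {E : Type*} [NormedAddCommGroup E] [InnerProductSpace ℝ E]
    [CompleteSpace E] {m : MeasurableSpace Ω} {T : Ω → E →L[ℝ] E} {x : Ω → E}
    (hT : Integrable T μ) (hx : StronglyMeasurable[m] x)
    (hxT : Integrable (fun ω => inner ℝ (x ω) (T ω (x ω))) μ) :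
    μ[fun ω => inner ℝ (x ω) (T ω (x ω)) | m]
      =ᵐ[μ] fun ω => inner ℝ (x ω) (μ[T | m] ω (x ω)) := by
  -- The form is linear in T: it is the functional S ↦ ⟨v, S v⟩ applied to T. This functional
  -- depends continuously on v, so at v = x it is m-measurable and can be pulled out.
  have hcont : Continuous fun v : E =>
      (innerSL ℝ v).comp (ContinuousLinearMap.apply ℝ E v) := by fun_prop
  exact condExp_bilin_of_stronglyMeasurable_left
    (ContinuousLinearMap.id ℝ ((E →L[ℝ] E) →L[ℝ] ℝ))
    (f := fun ω => (innerSL ℝ (x ω)).comp (ContinuousLinearMap.apply ℝ E (x ω)))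
    (hcont.comp_stronglyMeasurable hx) hxT hT

theorem condExp_inner_toEuclideanLin {q : ℕ} {m : MeasurableSpace Ω}
    {A : Ω → Matrix (Fin q) (Fin q) ℝ} {x : Ω → EuclideanSpace ℝ (Fin q)}
    (hA : Integrable A μ) (hx : StronglyMeasurable[m] x)
    (hxA : Integrable (fun ω => inner ℝ (x ω) (Matrix.toEuclideanLin (A ω) (x ω))) μ) :
    μ[fun ω => inner ℝ (x ω) (Matrix.toEuclideanLin (A ω) (x ω)) | m]
      =ᵐ[μ] fun ω => inner ℝ (x ω) (Matrix.toEuclideanLin (μ[A | m] ω) (x ω)) := by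
  have h1 := ContinuousLinearMap.comp_condExp_comm (m := m) hA (matrixToCLM q)
  have h2 := condExp_inner_clm_apply (m := m) (T := fun ω => matrixToCLM q (A ω))
    ((matrixToCLM q).integrable_comp hA) hx hxA
  refine h2.trans ?_
  filter_upwards [h1] with ω hω
  rw [← matrixToCLM_apply]
  exact congrArg (fun T : EuclideanSpace ℝ (Fin q) →L[ℝ] EuclideanSpace ℝ (Fin q) =>
    inner ℝ (x ω) (T (x ω))) hω.symm

/-- Conditional expectations of symmetric random matrices are symmetric. -/
theorem condExp_transpose_eq {q : ℕ} {A : Ω → Matrix (Fin q) (Fin q) ℝ} (m : MeasurableSpace Ω)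
    (hA : Integrable A μ) (hsymm : ∀ ω, (A ω)ᵀ = A ω) :
    ∀ᵐ ω ∂μ, (μ[A | m] ω)ᵀ = μ[A | m] ω := by
  have h1 := ContinuousLinearMap.comp_condExp_comm (m := m) hA
    (LinearMap.toContinuousLinearMap (Matrix.transposeLinearEquiv (Fin q) (Fin q) ℝ ℝ).toLinearMap)
  filter_upwards [h1] with ω hω
  have h2 : (LinearMap.toContinuousLinearMap
      (Matrix.transposeLinearEquiv (Fin q) (Fin q) ℝ ℝ).toLinearMap : _ → _) ∘ A = A :=
    funext hsymm
  rw [h2] at hω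
  exact hω

/-- A random vector known at an earlier time is orthogonal to a later martingale difference. -/
theorem setIntegral_inner_eq_zero [IsFiniteMeasure μ] {E : Type*} [NormedAddCommGroup E]
    [InnerProductSpace ℝ E] [CompleteSpace E] {m m' : MeasurableSpace Ω} (hmm' : m ≤ m')
    (hm' : m' ≤ m₀) {x n : Ω → E} (hx : StronglyMeasurable[m] x) (hxL2 : MemLp x 2 μ)
    (hn : MemLp n 2 μ) (hn_zero : μ[n | m'] =ᵐ[μ] 0) {s : Set Ω} (hs : MeasurableSet[m] s) :
    ∫ ω in s, inner ℝ (x ω) (n ω) ∂μ = 0 := by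
  have hint := hxL2.integrable_real_inner hn
  -- Conditioning is on the later σ-algebra m', which contains s and makes x measurable, so only the
  -- conditional mean of n remains.
  rw [← setIntegral_condExp hm' hint (hmm' s hs)]
  have h1 := condExp_bilin_of_stronglyMeasurable_left (m := m') (innerSL ℝ) (hx.mono hmm') hint
    (hn.integrable one_le_two)
  refine setIntegral_eq_zero_of_ae_eq_zero ?_
  filter_upwards [h1, hn_zero] with ω h1 h2 _
  rw [h2] at h1
  exact h1.trans (by simp)

/-- A conditional bound on an integrable function bounds its integral over past events. -/
theorem setIntegral_le_of_condExp_le [IsFiniteMeasure μ] {m : MeasurableSpace Ω} (hm : m ≤ m₀)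
    {f : Ω → ℝ} {c : ℝ} (hf : Integrable f μ) (hfc : ∀ᵐ ω ∂μ, μ[f | m] ω ≤ c) {s : Set Ω}
    (hs : MeasurableSet[m] s) : ∫ ω in s, f ω ∂μ ≤ c * μ.real s := by
  rw [← setIntegral_condExp hm hf hs]
  calc _ ≤ ∫ _ in s, c ∂μ :=
        setIntegral_mono_ae integrable_condExp.integrableOn (integrable_const c).integrableOn hfc
    _ = _ := by simp [mul_comm]

/-- If the conditional mean of the symmetrized sum of random matrices has largest eigenvalue at most
`-lam`, the corresponding quadratic form in past variables has mean at most `-lam ‖x‖²`. -/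
theorem setIntegral_sum_inner_le_of_lambdaMax_le [IsFiniteMeasure μ] {q : ℕ}
    {m : MeasurableSpace Ω} (hm : m ≤ m₀) {Q : ℕ → Ω → Matrix (Fin q) (Fin q) ℝ} (I : Finset ℕ)
    {lam π₁ : ℝ} (hQ_meas : ∀ t, Measurable[m₀] (Q t)) (hQ_bdd : ∀ t, ∀ᵐ ω ∂μ, ‖Q t ω‖ ≤ π₁)
    (hlam : ∀ᵐ ω ∂μ,
      lambdaMax (∑ t ∈ I, (μ[fun ω' => Q t ω' + (Q t ω')ᵀ | m]) ω) ≤ -lam)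
    {x : Ω → EuclideanSpace ℝ (Fin q)} (hx : StronglyMeasurable[m] x) (hxL2 : MemLp x 2 μ)
    {s : Set Ω} (hs : MeasurableSet[m] s) :
    ∫ ω in s, ∑ t ∈ I, 2 * inner ℝ (x ω) (Matrix.toEuclideanLin (Q t ω) (x ω)) ∂μ
      ≤ -lam * ∫ ω in s, ‖x ω‖ ^ 2 ∂μ := by
  set A : ℕ → Ω → Matrix (Fin q) (Fin q) ℝ := fun t ω => Q t ω + (Q t ω)ᵀ with hAdef
  have hA_apply : ∀ t ω, inner ℝ (x ω) (Matrix.toEuclideanLin (A t ω) (x ω))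
      = 2 * inner ℝ (x ω) (Matrix.toEuclideanLin (Q t ω) (x ω)) := by
    intro t ω
    rw [hAdef]
    simp only [map_add, LinearMap.add_apply, inner_add_right, inner_toEuclideanLin_transpose]
    ring
  have hxm : Measurable[m₀] x := (hx.mono hm).measurable
  have hQ_int : ∀ t, Integrable (Q t) μ := fun t =>
    Integrable.of_bound (hQ_meas t).stronglyMeasurable_matrix.aestronglyMeasurable π₁ (hQ_bdd t)
  have hA_int : ∀ t, Integrable (A t) μ := fun t =>
    (hQ_int t).add ((LinearMap.toContinuousLinearMap
      (Matrix.transposeLinearEquiv (Fin q) (Fin q) ℝ ℝ).toLinearMap).integrable_comp (hQ_int t))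
  have hA_symm : ∀ t ω, (A t ω)ᵀ = A t ω := fun t ω => by
    rw [hAdef]; simp [add_comm]
  have hQx : ∀ t, MemLp (fun ω => Matrix.toEuclideanLin (Q t ω) (x ω)) 2 μ := fun t => by
    refine hxL2.of_le_mul (c := π₁)
      (measurable_toEuclideanLin (hQ_meas t) hxm).aestronglyMeasurable ?_
    filter_upwards [hQ_bdd t] with ω hω
    exact (norm_toEuclideanLin_le _ _).trans (by gcongr)
  have hxA : ∀ t, Integrable
      (fun ω => inner ℝ (x ω) (Matrix.toEuclideanLin (A t ω) (x ω))) μ := fun t => by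
    simp only [hA_apply]
    exact (hxL2.integrable_real_inner (hQx t)).const_mul 2
  have hpull := fun t => condExp_inner_toEuclideanLin (hA_int t) hx (hxA t)
  have hpull_int : ∀ t, Integrable
      (fun ω => inner ℝ (x ω) (Matrix.toEuclideanLin (μ[A t | m] ω) (x ω))) μ := fun t =>
    integrable_condExp.congr (hpull t)
  simp only [← hA_apply]
  rw [integral_finsetSum _ fun t _ => (hxA t).integrableOn]
  have h1 : ∀ t, ∫ ω in s, inner ℝ (x ω) (Matrix.toEuclideanLin (A t ω) (x ω)) ∂μ
      = ∫ ω in s, inner ℝ (x ω) (Matrix.toEuclideanLin (μ[A t | m] ω) (x ω)) ∂μ := fun t => by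
    rw [← setIntegral_condExp hm (hxA t) hs]
    exact integral_congr_ae (ae_restrict_of_ae (hpull t))
  simp only [h1]
  rw [← integral_finsetSum _ fun t _ => (hpull_int t).integrableOn, ← integral_const_mul]
  have hsq : Integrable (fun ω => ‖x ω‖ ^ 2) μ :=
    (memLp_two_iff_integrable_sq_norm hxL2.aestronglyMeasurable).1 hxL2
  refine setIntegral_mono_ae (integrable_finsetSum _ fun t _ => hpull_int t).integrableOn
    (hsq.const_mul _).integrableOn ?_
  have hsymm : ∀ᵐ ω ∂μ, ∀ t, (μ[A t | m] ω)ᵀ = μ[A t | m] ω :=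
    ae_all_iff.2 fun t => condExp_transpose_eq m (hA_int t) (hA_symm t)
  filter_upwards [hsymm, hlam] with ω h2 h3
  have h4 : (∑ t ∈ I, μ[A t | m] ω)ᵀ = ∑ t ∈ I, μ[A t | m] ω := by
    rw [Matrix.transpose_sum]
    exact Finset.sum_congr rfl fun t _ => h2 t
  have h5 := inner_toEuclideanLin_le_lambdaMax h4 (x ω)
  rw [map_sum, LinearMap.sum_apply, inner_sum] at h5
  exact h5.trans (mul_le_mul_of_nonneg_right h3 (by positivity))

end CondExp

/-! ### The history filtration -/

section History

variable {Ω : Type*} {q : ℕ} {Q Δ : ℕ → Ω → Matrix (Fin q) (Fin q) ℝ}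
  {ε : ℕ → Ω → EuclideanSpace ℝ (Fin q)}

theorem history_mono : Monotone (history Q Δ ε) := fun _ _ hst =>
  biSup_mono fun _ hi => Finset.range_mono hst hi

theorem history_le [m₀ : MeasurableSpace Ω] (hQ : ∀ t, Measurable (Q t))
    (hΔ : ∀ t, Measurable (Δ t)) (hε : ∀ t, Measurable (ε t)) (t : ℕ) :
    history Q Δ ε t ≤ m₀ :=
  iSup₂_le fun s _ =>
    sup_le (hQ s).comap_le (sup_le (hΔ s).comap_le (hε s).comap_le)

theorem le_history_succ (t : ℕ) :
    MeasurableSpace.comap (Q t) inferInstance ⊔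
      (MeasurableSpace.comap (Δ t) inferInstance ⊔ MeasurableSpace.comap (ε t) inferInstance)
      ≤ history Q Δ ε (t + 1) :=
  le_iSup₂_of_le t (Finset.self_mem_range_succ t) le_rfl

theorem measurable_history_succ (t : ℕ) : Measurable[history Q Δ ε (t + 1)] (Q t) ∧
    Measurable[history Q Δ ε (t + 1)] (Δ t) ∧ Measurable[history Q Δ ε (t + 1)] (ε t) := by
  have h := le_history_succ (Q := Q) (Δ := Δ) (ε := ε) t
  refine ⟨Measurable.of_comap_le (le_sup_left.trans h),
    Measurable.of_comap_le ((le_sup_left.trans le_sup_right).trans h),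
    Measurable.of_comap_le ((le_sup_right.trans le_sup_right).trans h)⟩

end History

/-! ### Criteria for almost sure convergence -/

section Convergence

variable {Ω : Type*} {m₀ : MeasurableSpace Ω} {μ : Measure Ω}

theorem integral_affine_combination {f₁ f₂ f₃ f₄ : Ω → ℝ} (h₁ : Integrable f₁ μ)
    (h₂ : Integrable f₂ μ) (h₃ : Integrable f₃ μ) (h₄ : Integrable f₄ μ) (a b c : ℝ) :
    ∫ ω, (f₁ ω + a * f₂ ω + f₃ ω + b * f₁ ω + c * f₄ ω) ∂μ
      = ∫ ω, f₁ ω ∂μ + a * ∫ ω, f₂ ω ∂μ + ∫ ω, f₃ ω ∂μ + b * ∫ ω, f₁ ω ∂μ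
        + c * ∫ ω, f₄ ω ∂μ := by
  have i₂ : Integrable (fun ω => f₁ ω + a * f₂ ω) μ := h₁.add (h₂.const_mul a)
  have i₃ : Integrable (fun ω => f₁ ω + a * f₂ ω + f₃ ω) μ := i₂.add h₃
  have i₄ : Integrable (fun ω => f₁ ω + a * f₂ ω + f₃ ω + b * f₁ ω) μ := i₃.add (h₁.const_mul b)
  rw [integral_add i₄ (h₄.const_mul c), integral_add i₃ (h₁.const_mul b), integral_add i₂ h₃,
    integral_add h₁ (h₂.const_mul a), integral_const_mul, integral_const_mul, integral_const_mul]

/-- By Tonelli the series Σ f t has finite mean, so it is finite almost surely and its terms vanish.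
-/
theorem ae_tendsto_zero_of_summable_integral {f : ℕ → Ω → ℝ} (hf : ∀ t ω, 0 ≤ f t ω)
    (hint : ∀ t, Integrable (f t) μ) (hsum : Summable fun t => ∫ ω, f t ω ∂μ) :
    ∀ᵐ ω ∂μ, Tendsto (fun t => f t ω) atTop (𝓝 0) := by
  have h1 : ∫⁻ ω, ∑' t, ENNReal.ofReal (f t ω) ∂μ ≠ ⊤ := by
    rw [lintegral_tsum fun t => (hint t).aemeasurable.ennreal_ofReal]
    simp only [← ofReal_integral_eq_lintegral_ofReal (hint _) (ae_of_all _ (hf _))]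
    exact hsum.tsum_ofReal_ne_top
  have hmeas : AEMeasurable (fun ω => ∑' t, ENNReal.ofReal (f t ω)) μ :=
    AEMeasurable.tsum fun t => (hint t).aemeasurable.ennreal_ofReal
  filter_upwards [ae_lt_top' hmeas h1] with ω hω
  have h2 := (ENNReal.tendsto_toReal ENNReal.zero_ne_top).comp
    (ENNReal.tendsto_atTop_zero_of_tsum_ne_top hω.ne)
  simpa [Function.comp_def, ENNReal.toReal_ofReal (hf _ ω)] using h2

/-- A nonnegative adapted process which is a supermartingale up to summable errors and tends to zero
in mean tends to zero almost surely. -/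
theorem ae_tendsto_zero_of_almost_supermartingale [IsProbabilityMeasure μ]
    {𝒢 : Filtration ℕ m₀} {V : ℕ → Ω → ℝ} {b : ℕ → ℝ} (hV : ∀ m ω, 0 ≤ V m ω)
    (hadp : StronglyAdapted 𝒢 V) (hint : ∀ m, Integrable (V m) μ) (hb : ∀ m, 0 ≤ b m)
    (hb_sum : Summable b)
    (hstep : ∀ m s, MeasurableSet[𝒢 m] s →
      ∫ ω in s, V (m + 1) ω ∂μ ≤ ∫ ω in s, V m ω ∂μ + b m * μ.real s)
    (hmean : Tendsto (fun m => ∫ ω, V m ω ∂μ) atTop (𝓝 0)) :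
    ∀ᵐ ω ∂μ, Tendsto (fun m => V m ω) atTop (𝓝 0) := by
  set B : ℕ → ℝ := fun m => ∑ k ∈ Finset.range m, b k with hB
  have hB0 : ∀ m, 0 ≤ B m := fun m => Finset.sum_nonneg fun k _ => hb k
  have hBle : ∀ m, B m ≤ ∑' k, b k := fun m => hb_sum.sum_le_tsum _ fun k _ => hb k
  -- Compensating by the accumulated errors turns V into a genuine submartingale B - V, bounded in
  -- L¹ because both B and the means of V are bounded.
  set Z : ℕ → Ω → ℝ := fun m ω => B m - V m ω with hZ
  have hZint : ∀ m, Integrable (Z m) μ := fun m => (integrable_const _).sub (hint m)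
  have hsub : Submartingale Z 𝒢 μ := by
    refine submartingale_of_setIntegral_le_succ
      (fun m => stronglyMeasurable_const.sub (hadp m)) hZint fun m s hs => ?_
    have h1 := hstep m s hs
    have h2 : ∀ k, ∫ ω in s, Z k ω ∂μ = B k * μ.real s - ∫ ω in s, V k ω ∂μ := fun k => by
      simp only [hZ]
      rw [integral_sub (integrable_const _) (hint k).integrableOn, setIntegral_const, smul_eq_mul,
        mul_comm]
    have h3 : B (m + 1) = B m + b m := Finset.sum_range_succ _ _
    rw [h2, h2, h3]
    linarith
  obtain ⟨D, hD⟩ := hmean.bddAbove_range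
  have hD' : ∀ m, ∫ ω, V m ω ∂μ ≤ D := fun m => hD ⟨m, rfl⟩
  have hbound : ∀ m, eLpNorm (Z m) 1 μ ≤ ((∑' k, b k + D).toNNReal : ENNReal) := by
    intro m
    rw [eLpNorm_one_eq_lintegral_enorm, ← ofReal_integral_norm_eq_lintegral_enorm (hZint m)]
    refine ENNReal.ofReal_le_ofReal ?_
    calc ∫ ω, ‖Z m ω‖ ∂μ ≤ ∫ ω, (B m + V m ω) ∂μ := by
          refine integral_mono (hZint m).norm ((integrable_const _).add (hint m)) fun ω => ?_
          simp only [hZ, Real.norm_eq_abs, abs_le]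
          constructor <;> linarith [hB0 m, hV m ω]
      _ = B m + ∫ ω, V m ω ∂μ := by
          rw [integral_add (integrable_const _) (hint m)]; simp
      _ ≤ _ := add_le_add (hBle m) (hD' m)
  -- Convergence in mean supplies a subsequence tending to zero almost surely, which identifies the
  -- almost sure limit of V.
  have hmeasure : TendstoInMeasure μ V atTop 0 := by
    refine tendstoInMeasure_of_tendsto_eLpNorm one_ne_zero
      (fun m => (hint m).aestronglyMeasurable) aestronglyMeasurable_zero ?_
    have h1 : ∀ m, eLpNorm (V m - 0) 1 μ = ENNReal.ofReal (∫ ω, V m ω ∂μ) := fun m => by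
      rw [sub_zero, eLpNorm_one_eq_lintegral_enorm,
        ← ofReal_integral_norm_eq_lintegral_enorm (hint m)]
      simp only [Real.norm_of_nonneg (hV m _)]
    simp only [h1]
    simpa [Function.comp_def] using (ENNReal.continuous_ofReal.tendsto 0).comp hmean
  obtain ⟨ns, hns, hns_lim⟩ := hmeasure.exists_seq_tendsto_ae
  filter_upwards [hsub.exists_ae_tendsto_of_bdd hbound, hns_lim] with ω ⟨c, hc⟩ hω
  have h1 : Tendsto (fun m => V m ω) atTop (𝓝 (∑' k, b k - c)) := by
    refine (hb_sum.hasSum.tendsto_sum_nat.sub hc).congr fun m => ?_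
    simp only [hZ, hB]; ring
  have h2 := tendsto_nhds_unique (h1.comp hns.tendsto_atTop) hω
  rwa [h2] at h1

end Convergence

/-! ### Measurability, moments and drift of the recursion -/

/-- The state at time t involves only data before t, so it is known one step before the noise ε'(t);
the drift and orthogonality arguments rest on this delay. -/
theorem measurable_history_state {Ω : Type*} {q : ℕ} {α : ℕ → ℝ}
    {Q Δ : ℕ → Ω → Matrix (Fin q) (Fin q) ℝ} {ε' ε'' e : ℕ → Ω → EuclideanSpace ℝ (Fin q)}
    (e₀ : EuclideanSpace ℝ (Fin q))
    (hε''_meas : ∀ t, Measurable[history Q Δ ε' (t + 1)] (ε'' t))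
    (he_zero : ∀ ω, e 0 ω = e₀)
    (he_succ : ∀ t ω, e (t + 1) ω = e t ω
      + α t • Matrix.toEuclideanLin (Q t ω + Δ t ω) (e t ω) + α t • (ε' t ω + ε'' t ω)) (t : ℕ) :
    Measurable[history Q Δ ε' t] (e t) := by
  induction t with
  | zero =>
    rw [show e 0 = fun _ => e₀ from funext he_zero]
    exact measurable_const
  | succ t ih =>
    obtain ⟨h1, h2, h3⟩ := measurable_history_succ (Q := Q) (Δ := Δ) (ε := ε') t
    have h4 : Measurable[history Q Δ ε' (t + 1)] (e t) := ih.mono (history_mono t.le_succ) le_rfl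
    have h5 : Measurable[history Q Δ ε' (t + 1)] fun ω => Q t ω + Δ t ω :=
      Measurable.add (M := Fin q → Fin q → ℝ) h1 h2
    rw [show e (t + 1) = _ from funext (he_succ t)]
    exact (h4.add ((measurable_toEuclideanLin h5 h4).const_smul (α t))).add
      ((h3.add (hε''_meas t)).const_smul (α t))

section Recursion

variable {Ω : Type*} [m₀ : MeasurableSpace Ω] {μ : Measure Ω} {q : ℕ}
  {α γ₁ γ₂ : ℕ → ℝ} {Q Δ : ℕ → Ω → Matrix (Fin q) (Fin q) ℝ}
  {ε' ε'' e : ℕ → Ω → EuclideanSpace ℝ (Fin q)}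

/-- A crude growth bound, needed only to bridge the fewer than h steps after a block start, where
the size of the constant is immaterial. -/
theorem ae_norm_state_succ_le {π₁ A G : ℝ} (hα_pos : ∀ t, 0 < α t) (hA : ∀ t, α t ≤ A)
    (hπ₁ : 0 < π₁) (hG : ∀ t, γ₁ t ≤ G) (hG0 : 0 ≤ G)
    (hQ : ∀ t, ∀ᵐ ω ∂μ, ‖Q t ω‖ ≤ π₁) (hΔ : ∀ t, ∀ᵐ ω ∂μ, ‖Δ t ω‖ ≤ γ₁ t)
    (hε'' : ∀ t, ∀ᵐ ω ∂μ, ‖ε'' t ω‖ ≤ γ₂ t)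
    (he_succ : ∀ t ω, e (t + 1) ω = e t ω
      + α t • Matrix.toEuclideanLin (Q t ω + Δ t ω) (e t ω) + α t • (ε' t ω + ε'' t ω)) :
    ∀ᵐ ω ∂μ, ∀ t, ‖e (t + 1) ω‖
      ≤ (1 + A * (π₁ + G)) * ‖e t ω‖ + (α t * ‖ε' t ω‖ + α t * γ₂ t) := by
  filter_upwards [ae_all_iff.2 hQ, ae_all_iff.2 hΔ, ae_all_iff.2 hε''] with ω h1 h2 h3 t
  have ha := (hα_pos t).le
  have h4 : ‖Matrix.toEuclideanLin (Q t ω + Δ t ω) (e t ω)‖ ≤ (π₁ + G) * ‖e t ω‖ := by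
    refine (norm_toEuclideanLin_le _ _).trans ?_
    gcongr
    exact (norm_add_le _ _).trans (add_le_add (h1 t) ((h2 t).trans (hG t)))
  rw [he_succ]
  calc _ ≤ ‖e t ω‖ + α t * ‖Matrix.toEuclideanLin (Q t ω + Δ t ω) (e t ω)‖
        + α t * ‖ε' t ω + ε'' t ω‖ := by
        refine (norm_add₃_le).trans ?_
        rw [norm_smul, norm_smul, Real.norm_of_nonneg ha]
    _ ≤ ‖e t ω‖ + A * ((π₁ + G) * ‖e t ω‖) + α t * (‖ε' t ω‖ + γ₂ t) := by
        gcongr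
        · exact ha.trans (hA t)
        · exact hA t
        · exact (norm_add_le _ _).trans (by gcongr; exact h3 t)
    _ = _ := by ring

variable [IsProbabilityMeasure μ]

theorem memLp_state {π₁ : ℝ} (e₀ : EuclideanSpace ℝ (Fin q))
    (hQ_meas : ∀ t, Measurable (Q t)) (hΔ_meas : ∀ t, Measurable (Δ t))
    (hε''_meas : ∀ t, Measurable (ε'' t)) (he_meas : ∀ t, Measurable (e t))
    (hQ : ∀ t, ∀ᵐ ω ∂μ, ‖Q t ω‖ ≤ π₁) (hΔ : ∀ t, ∀ᵐ ω ∂μ, ‖Δ t ω‖ ≤ γ₁ t)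
    (hε' : ∀ t, MemLp (ε' t) 2 μ) (hε'' : ∀ t, ∀ᵐ ω ∂μ, ‖ε'' t ω‖ ≤ γ₂ t)
    (he_zero : ∀ ω, e 0 ω = e₀)
    (he_succ : ∀ t ω, e (t + 1) ω = e t ω
      + α t • Matrix.toEuclideanLin (Q t ω + Δ t ω) (e t ω) + α t • (ε' t ω + ε'' t ω)) (t : ℕ) :
    MemLp (e t) 2 μ := by
  induction t with
  | zero =>
    rw [show e 0 = fun _ => e₀ from funext he_zero]
    exact memLp_const _
  | succ t ih =>
    have h5 : Measurable fun ω => Q t ω + Δ t ω :=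
      Measurable.add (M := Fin q → Fin q → ℝ) (hQ_meas t) (hΔ_meas t)
    have h6 : MemLp (fun ω => Matrix.toEuclideanLin (Q t ω + Δ t ω) (e t ω)) 2 μ := by
      refine ih.of_le_mul (c := π₁ + γ₁ t)
        (measurable_toEuclideanLin h5 (he_meas t)).aestronglyMeasurable ?_
      filter_upwards [hQ t, hΔ t] with ω h1 h2
      refine (norm_toEuclideanLin_le _ _).trans ?_
      gcongr
      exact (norm_add_le _ _).trans (add_le_add h1 h2)
    have h7 : MemLp (ε'' t) 2 μ :=
      MemLp.of_bound (hε''_meas t).aestronglyMeasurable (γ₂ t) (hε'' t)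
    rw [show e (t + 1) = _ from funext (he_succ t)]
    exact (ih.add (h6.const_smul (α t))).add (((hε' t).add h7).const_smul (α t))

/-- The scaled second moment bound on the noise, over past events. -/
theorem setIntegral_step_mul_noise_le {m : MeasurableSpace Ω} (hm : m ≤ m₀) {a δ c : ℝ}
    (ha : 0 < a) {n : Ω → EuclideanSpace ℝ (Fin q)}
    (hn_int : Integrable (fun ω => ‖a ^ δ • n ω‖ ^ 2) μ)
    (hn : ∀ᵐ ω ∂μ, (μ[fun ω' => ‖a ^ δ • n ω'‖ ^ 2 | m]) ω ≤ c) {s : Set Ω}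
    (hs : MeasurableSet[m] s) :
    ∫ ω in s, a ^ 2 * ‖n ω‖ ^ 2 ∂μ ≤ a ^ (2 * (1 - δ)) * c * μ.real s := by
  -- Writing a² = a^(2(1-δ)) (a^δ)² isolates the scaled noise, whose conditional second moment is
  -- bounded.
  have h1 : ∀ ω, a ^ 2 * ‖n ω‖ ^ 2 = a ^ (2 * (1 - δ)) * ‖a ^ δ • n ω‖ ^ 2 := fun ω => by
    rw [norm_smul, mul_pow, Real.norm_of_nonneg (by positivity), ← mul_assoc,
      ← Real.rpow_natCast (a ^ δ), ← Real.rpow_mul ha.le, ← Real.rpow_add ha]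
    congr 1
    rw [← Real.rpow_natCast a]
    congr 1
    push_cast; ring
  simp only [h1]
  rw [integral_const_mul, mul_assoc]
  exact mul_le_mul_of_nonneg_left (setIntegral_le_of_condExp_le hm hn_int hn hs) (by positivity)

/-- Conditional drift of the squared error over a block of `h` steps. -/
theorem exists_eventually_setIntegral_block_le {π₁ lam δ cε : ℝ} {h : ℕ} (hh : 0 < h)
    (hπ₁ : 0 < π₁) (hlam : 0 < lam)
    (hα_pos : ∀ t, 0 < α t) (hα_zero : Tendsto α atTop (𝓝 0))
    (hα_comp : ∀ κ > 0, ∀ᶠ t in atTop, ∀ j < h, |α (t + j) - α t| ≤ κ * α t)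
    (hγ₁_zero : Tendsto γ₁ atTop (𝓝 0))
    (hγ₂_nonneg : ∀ t, 0 ≤ γ₂ t) (hγ₂_zero : Tendsto γ₂ atTop (𝓝 0))
    (hQ_meas : ∀ t, Measurable (Q t)) (hΔ_meas : ∀ t, Measurable (Δ t))
    (hε'_meas : ∀ t, Measurable (ε' t))
    (hQ : ∀ t, ∀ᵐ ω ∂μ, ‖Q t ω‖ ≤ π₁) (hΔ : ∀ t, ∀ᵐ ω ∂μ, ‖Δ t ω‖ ≤ γ₁ t)
    (hQ_neg : ∀ m : ℕ, ∀ᵐ ω ∂μ,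
      lambdaMax (∑ t ∈ Finset.Ico (m * h) ((m + 1) * h),
        (μ[fun ω' => Q t ω' + (Q t ω')ᵀ | history Q Δ ε' (m * h)]) ω) ≤ -lam)
    (hε'_memLp : ∀ t, MemLp (ε' t) 2 μ)
    (hε'_mds : ∀ t, μ[ε' t | history Q Δ ε' t] =ᵐ[μ] 0)
    (hε'_sq_int : ∀ t, Integrable (fun ω => ‖α t ^ δ • ε' t ω‖ ^ 2) μ)
    (hε'_sq : ∀ t, ∀ᵐ ω ∂μ,
      (μ[fun ω' => ‖α t ^ δ • ε' t ω'‖ ^ 2 | history Q Δ ε' t]) ω ≤ cε)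
    (hε'' : ∀ t, ∀ᵐ ω ∂μ, ‖ε'' t ω‖ ≤ γ₂ t)
    (he_meas : ∀ t, Measurable[history Q Δ ε' t] (e t)) (he : ∀ t, MemLp (e t) 2 μ)
    (he_succ : ∀ t ω, e (t + 1) ω = e t ω
      + α t • Matrix.toEuclideanLin (Q t ω + Δ t ω) (e t ω) + α t • (ε' t ω + ε'' t ω)) :
    ∃ C > 0, ∀ᶠ m in atTop, ∀ s, MeasurableSet[history Q Δ ε' (m * h)] s →
      ∫ ω in s, ‖e ((m + 1) * h) ω‖ ^ 2 ∂μ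
        ≤ (1 - lam / 2 * α (m * h)) * ∫ ω in s, ‖e (m * h) ω‖ ^ 2 ∂μ
          + C * (∑ j ∈ Finset.range h, (α (m * h + j) ^ (2 * (1 - δ)) * cε
            + α (m * h + j) * γ₂ (m * h + j))) * μ.real s := by
  obtain ⟨C, hC, hblock⟩ := exists_block_norm_sq_le (E := EuclideanSpace ℝ (Fin q)) π₁ hπ₁ h
  refine ⟨C, hC, ?_⟩
  -- C does not depend on κ, so κ can be taken small enough for the errors to consume at most half
  -- of the drift λ.
  obtain ⟨κ, hκ, hκ1, hCκ⟩ : ∃ κ > 0, κ ≤ 1 ∧ C * κ ≤ lam / 2 := by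
    refine ⟨min 1 (lam / 2 / C), by positivity, min_le_left _ _, ?_⟩
    calc _ ≤ C * (lam / 2 / C) := by gcongr; exact min_le_right _ _
      _ = _ := by field_simp
  have hev : ∀ {f : ℕ → ℝ}, Tendsto f atTop (𝓝 0) → ∀ᶠ t in atTop, ∀ j, f (t + j) ≤ κ := by
    intro f hf
    obtain ⟨T, hT⟩ := eventually_atTop.1 (hf.eventually_le_const hκ)
    filter_upwards [eventually_ge_atTop T] with t ht j
    exact hT _ (ht.trans (Nat.le_add_right _ _))
  have hmh : Tendsto (fun m : ℕ => m * h) atTop atTop := tendsto_id.atTop_mul_const' hh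
  filter_upwards [hmh.eventually (hev hα_zero), hmh.eventually (hev hγ₁_zero),
    hmh.eventually (hev hγ₂_zero), hmh.eventually (hα_comp κ hκ)] with m hm1 hm2 hm3 hm4 s hs
  set T := m * h with hT
  have hTh : (m + 1) * h = T + h := by rw [add_mul, one_mul]
  have hle : ∀ t, history Q Δ ε' t ≤ m₀ := history_le hQ_meas hΔ_meas hε'_meas
  have ha := hα_pos T
  have hsq : ∀ {x : Ω → EuclideanSpace ℝ (Fin q)}, MemLp x 2 μ →
      Integrable (fun ω => ‖x ω‖ ^ 2) μ := fun hx =>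
    (memLp_two_iff_integrable_sq_norm hx.aestronglyMeasurable).1 hx
  have he_sm : StronglyMeasurable[history Q Δ ε' T] (e T) := (he_meas T).stronglyMeasurable
  have hQe : ∀ t, Integrable
      (fun ω => inner ℝ (e T ω) (Matrix.toEuclideanLin (Q t ω) (e T ω))) μ := fun t => by
    refine (he T).integrable_real_inner ((he T).of_le_mul (c := π₁) ?_ ?_)
    · exact (measurable_toEuclideanLin (hQ_meas t)
        ((he_meas T).mono (hle T) le_rfl)).aestronglyMeasurable
    · filter_upwards [hQ t] with ω hω
      exact (norm_toEuclideanLin_le _ _).trans (by gcongr)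
  have hpath : ∀ᵐ ω ∂μ, ‖e (T + h) ω‖ ^ 2 ≤ ‖e T ω‖ ^ 2
      + α T * ∑ j ∈ Finset.range h,
          2 * inner ℝ (e T ω) (Matrix.toEuclideanLin (Q (T + j) ω) (e T ω))
      + ∑ j ∈ Finset.range h, 2 * α (T + j) * inner ℝ (e T ω) (ε' (T + j) ω)
      + lam / 2 * α T * ‖e T ω‖ ^ 2
      + C * ∑ j ∈ Finset.range h,
          (α (T + j) ^ 2 * ‖ε' (T + j) ω‖ ^ 2 + α (T + j) * γ₂ (T + j)) := by
    filter_upwards [ae_all_iff.2 hQ, ae_all_iff.2 hΔ, ae_all_iff.2 hε''] with ω h1 h2 h3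
    have h4 := hblock (fun j => e (T + j) ω) (fun j => Matrix.toEuclideanLin (Q (T + j) ω))
      (fun j => Matrix.toEuclideanLin (Δ (T + j) ω)) (fun j => ε' (T + j) ω)
      (fun j => ε'' (T + j) ω) (fun j => α (T + j)) (fun j => γ₂ (T + j)) (α T) κ hκ1 ha
      (hm1 0) (fun j _ => hα_pos _) hm4 (fun j _ => hγ₂_nonneg _) (fun j _ => hm3 j)
      (fun j _ => h3 _)
      (fun j _ v => (norm_toEuclideanLin_le _ _).trans (by gcongr; exact h1 _))
      (fun j _ v => (norm_toEuclideanLin_le _ _).trans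
        (by gcongr; exact (h2 _).trans (hm2 j)))
      (fun j _ => by
        have := he_succ (T + j) ω
        rwa [map_add, LinearMap.add_apply] at this)
    refine h4.trans ?_
    simp only [add_zero]
    have : C * κ * α T * ‖e T ω‖ ^ 2 ≤ lam / 2 * α T * ‖e T ω‖ ^ 2 := by gcongr
    linarith
  have i1 : Integrable (fun ω => ‖e T ω‖ ^ 2) μ := hsq (he T)
  have i2 : Integrable (fun ω => ∑ j ∈ Finset.range h,
      2 * inner ℝ (e T ω) (Matrix.toEuclideanLin (Q (T + j) ω) (e T ω))) μ :=
    integrable_finsetSum _ fun j _ => (hQe _).const_mul 2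
  have i3' : ∀ j, Integrable (fun ω => 2 * α (T + j) * inner ℝ (e T ω) (ε' (T + j) ω)) μ :=
    fun j => ((he T).integrable_real_inner (hε'_memLp _)).const_mul _
  have i3 : Integrable (fun ω => ∑ j ∈ Finset.range h,
      2 * α (T + j) * inner ℝ (e T ω) (ε' (T + j) ω)) μ :=
    integrable_finsetSum _ fun j _ => i3' j
  have i4' : ∀ j, Integrable (fun ω => α (T + j) ^ 2 * ‖ε' (T + j) ω‖ ^ 2) μ :=
    fun j => (hsq (hε'_memLp _)).const_mul _
  have i5' : ∀ j, Integrable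
      (fun ω => α (T + j) ^ 2 * ‖ε' (T + j) ω‖ ^ 2 + α (T + j) * γ₂ (T + j)) μ :=
    fun j => (i4' j).add (integrable_const _)
  have i5 : Integrable (fun ω => ∑ j ∈ Finset.range h,
      (α (T + j) ^ 2 * ‖ε' (T + j) ω‖ ^ 2 + α (T + j) * γ₂ (T + j))) μ :=
    integrable_finsetSum _ fun j _ => i5' j
  have hquad : ∫ ω in s, ∑ j ∈ Finset.range h,
      2 * inner ℝ (e T ω) (Matrix.toEuclideanLin (Q (T + j) ω) (e T ω)) ∂μ
      ≤ -lam * ∫ ω in s, ‖e T ω‖ ^ 2 ∂μ := by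
    have h1 := setIntegral_sum_inner_le_of_lambdaMax_le (hle T)
      (Finset.Ico (m * h) ((m + 1) * h)) hQ_meas hQ (hQ_neg m) he_sm (he T) hs
    have h2 : (m + 1) * h - m * h = h := by rw [add_mul, one_mul, Nat.add_sub_cancel_left]
    simpa only [Finset.sum_Ico_eq_sum_range, h2] using h1
  have hnoise : ∫ ω in s, ∑ j ∈ Finset.range h,
      2 * α (T + j) * inner ℝ (e T ω) (ε' (T + j) ω) ∂μ = 0 := by
    rw [integral_finsetSum _ fun j _ => (i3' j).integrableOn]
    refine Finset.sum_eq_zero fun j _ => ?_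
    -- The noise is paired with the state at the block start T, which is known before every time T +
    -- j.
    rw [integral_const_mul, setIntegral_inner_eq_zero (history_mono (Nat.le_add_right T j))
      (hle _) he_sm (he T) (hε'_memLp _) (hε'_mds _) hs, mul_zero]
  have hrem : ∫ ω in s, ∑ j ∈ Finset.range h,
      (α (T + j) ^ 2 * ‖ε' (T + j) ω‖ ^ 2 + α (T + j) * γ₂ (T + j)) ∂μ
      ≤ (∑ j ∈ Finset.range h, (α (T + j) ^ (2 * (1 - δ)) * cε
        + α (T + j) * γ₂ (T + j))) * μ.real s := by
    rw [integral_finsetSum _ fun j _ => (i5' j).integrableOn, Finset.sum_mul]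
    refine Finset.sum_le_sum fun j _ => ?_
    rw [integral_add (i4' j).integrableOn (integrable_const _), add_mul, setIntegral_const,
      smul_eq_mul, mul_comm (μ.real s)]
    gcongr
    exact setIntegral_step_mul_noise_le (hle _) (hα_pos _) (hε'_sq_int _) (hε'_sq _)
      (history_mono (Nat.le_add_right T j) s hs)
  rw [hTh]
  calc ∫ ω in s, ‖e (T + h) ω‖ ^ 2 ∂μ
      ≤ ∫ ω in s, (‖e T ω‖ ^ 2
        + α T * ∑ j ∈ Finset.range h,
            2 * inner ℝ (e T ω) (Matrix.toEuclideanLin (Q (T + j) ω) (e T ω))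
        + ∑ j ∈ Finset.range h, 2 * α (T + j) * inner ℝ (e T ω) (ε' (T + j) ω)
        + lam / 2 * α T * ‖e T ω‖ ^ 2
        + C * ∑ j ∈ Finset.range h,
            (α (T + j) ^ 2 * ‖ε' (T + j) ω‖ ^ 2 + α (T + j) * γ₂ (T + j))) ∂μ :=
        setIntegral_mono_ae (hsq (he _)).integrableOn
          ((((i1.add (i2.const_mul _)).add i3).add (i1.const_mul _)).add
            (i5.const_mul _)).integrableOn hpath
    _ = ∫ ω in s, ‖e T ω‖ ^ 2 ∂μ
        + α T * ∫ ω in s, ∑ j ∈ Finset.range h,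
            2 * inner ℝ (e T ω) (Matrix.toEuclideanLin (Q (T + j) ω) (e T ω)) ∂μ
        + ∫ ω in s, ∑ j ∈ Finset.range h,
            2 * α (T + j) * inner ℝ (e T ω) (ε' (T + j) ω) ∂μ
        + lam / 2 * α T * ∫ ω in s, ‖e T ω‖ ^ 2 ∂μ
        + C * ∫ ω in s, ∑ j ∈ Finset.range h,
            (α (T + j) ^ 2 * ‖ε' (T + j) ω‖ ^ 2 + α (T + j) * γ₂ (T + j)) ∂μ :=
        integral_affine_combination i1.integrableOn i2.integrableOn i3.integrableOn
          i5.integrableOn _ _ _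
    _ ≤ _ := by
        rw [hnoise, mul_assoc C]
        have h1 := mul_le_mul_of_nonneg_left hquad ha.le
        have h2 := mul_le_mul_of_nonneg_left hrem hC.le
        linarith

theorem integral_norm_sq_state_succ_le {C : ℝ} (t : ℕ)
    (he : ∀ t, MemLp (e t) 2 μ) (hε' : MemLp (ε' t) 2 μ)
    (hstep : ∀ᵐ ω ∂μ, ‖e (t + 1) ω‖ ≤ C * ‖e t ω‖ + (α t * ‖ε' t ω‖ + α t * γ₂ t)) :
    ∫ ω, ‖e (t + 1) ω‖ ^ 2 ∂μ ≤ 3 * C ^ 2 * ∫ ω, ‖e t ω‖ ^ 2 ∂μ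
      + 3 * (∫ ω, α t ^ 2 * ‖ε' t ω‖ ^ 2 ∂μ + (α t * γ₂ t) ^ 2) := by
  have hsq : ∀ {x : Ω → EuclideanSpace ℝ (Fin q)}, MemLp x 2 μ →
      Integrable (fun ω => ‖x ω‖ ^ 2) μ := fun hx =>
    (memLp_two_iff_integrable_sq_norm hx.aestronglyMeasurable).1 hx
  have i1 : Integrable (fun ω => 3 * C ^ 2 * ‖e t ω‖ ^ 2) μ := (hsq (he t)).const_mul _
  have i2 : Integrable (fun ω => α t ^ 2 * ‖ε' t ω‖ ^ 2) μ := (hsq hε').const_mul _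
  have i3 : Integrable (fun ω => α t ^ 2 * ‖ε' t ω‖ ^ 2 + (α t * γ₂ t) ^ 2) μ :=
    i2.add (integrable_const _)
  calc ∫ ω, ‖e (t + 1) ω‖ ^ 2 ∂μ
      ≤ ∫ ω, (3 * C ^ 2 * ‖e t ω‖ ^ 2
          + 3 * (α t ^ 2 * ‖ε' t ω‖ ^ 2 + (α t * γ₂ t) ^ 2)) ∂μ := by
        refine integral_mono_ae (hsq (he _)) (i1.add (i3.const_mul 3)) ?_
        filter_upwards [hstep] with ω hω
        have h1 : ‖e (t + 1) ω‖ ^ 2 ≤ (C * ‖e t ω‖ + (α t * ‖ε' t ω‖ + α t * γ₂ t)) ^ 2 := by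
          gcongr
        nlinarith [sq_nonneg (C * ‖e t ω‖ - α t * ‖ε' t ω‖), sq_nonneg (C * ‖e t ω‖ - α t * γ₂ t),
          sq_nonneg (α t * ‖ε' t ω‖ - α t * γ₂ t)]
    _ = _ := by
        rw [integral_add i1 (i3.const_mul 3), integral_const_mul, integral_const_mul,
          integral_add i2 (integrable_const _)]
        simp

end Recursion

/-! ### From block drift to convergence -/

/-- Block sums of `α ρ` with `ρ → 0` are negligible compared with the step at the block start. -/
theorem eventually_sum_block_le {α ρ : ℕ → ℝ} {h : ℕ} (hh : 0 < h) (hα_pos : ∀ t, 0 < α t)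
    (hρ : ∀ t, 0 ≤ ρ t) (hρ_zero : Tendsto ρ atTop (𝓝 0))
    (hcomp : ∀ᶠ t in atTop, ∀ j < h, α (t + j) ≤ 2 * α t) {κ : ℝ} (hκ : 0 < κ) :
    ∀ᶠ m in atTop, ∑ j ∈ Finset.range h, α (m * h + j) * ρ (m * h + j) ≤ κ * α (m * h) := by
  have hmh : Tendsto (fun m : ℕ => m * h) atTop atTop := tendsto_id.atTop_mul_const' hh
  have hh' : (0 : ℝ) < h := by exact_mod_cast hh
  obtain ⟨T, hT⟩ := eventually_atTop.1
    (hρ_zero.eventually_le_const (show 0 < κ / (2 * h) by positivity))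
  filter_upwards [hmh.eventually hcomp, hmh.eventually_ge_atTop T] with m h1 h2
  have ha := (hα_pos (m * h)).le
  calc _ ≤ ∑ j ∈ Finset.range h, 2 * α (m * h) * (κ / (2 * h)) :=
        Finset.sum_le_sum fun j hj => mul_le_mul (h1 j (Finset.mem_range.1 hj))
          (hT _ (h2.trans (Nat.le_add_right _ _))) (hρ _) (by positivity)
    _ = _ := by
        rw [Finset.sum_const, Finset.card_range, nsmul_eq_mul]
        field_simp

theorem theorem5 {Ω : Type*} [MeasurableSpace Ω] (μ : Measure Ω) [IsProbabilityMeasure μ]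
    {q : ℕ} (α : ℕ → ℝ)
    (Q Δ : ℕ → Ω → Matrix (Fin q) (Fin q) ℝ)
    (ε' ε'' : ℕ → Ω → EuclideanSpace ℝ (Fin q))
    -- the step sizes
    (hα_pos : ∀ t, 0 < α t)
    (hα_zero : Tendsto α atTop (𝓝 0))
    (hα_sum : Tendsto (fun n : ℕ => ∑ t ∈ Finset.Icc 1 n, α t) atTop atTop)
    (α₀ : ℝ) (hα₀ : 0 ≤ α₀)
    (hα_inv : Tendsto (fun t => 1 / α (t + 1) - 1 / α t) atTop (𝓝 α₀))
    -- the random matrices `Q t`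
    (hQ_meas : ∀ t, Measurable (Q t))
    (π₁ : ℝ) (hπ₁ : 0 < π₁)
    (hQ_bdd : ∀ᵐ ω ∂μ, ∀ t, ‖Q t ω‖ ≤ π₁)
    (h : ℕ) (hh : 0 < h) (lam : ℝ) (hlam : 0 < lam)
    (hQ_neg : ∀ m : ℕ, ∀ᵐ ω ∂μ,
      lambdaMax (∑ t ∈ Finset.Ico (m * h) ((m + 1) * h),
        (μ[fun ω' => Q t ω' + (Q t ω')ᵀ | history Q Δ ε' (m * h)]) ω) ≤ -lam)
    -- the random matrices `Δ t`
    (hΔ_meas : ∀ t, Measurable (Δ t))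
    (g₁ : ℝ≥0 → ℝ) (hg₁_meas : Measurable g₁) (hg₁_pos : ∀ t, 0 < g₁ t)
    (hg₁_zero : Tendsto g₁ atTop (𝓝 0)) (hg₁_bdd : BddAbove (Set.range g₁))
    (hΔ : ∀ t : ℕ, ∀ᵐ ω ∂μ, ‖Δ t ω‖ ≤ g₁ (t : ℝ≥0))
    -- the martingale difference noise `ε' t`
    (hε'_meas : ∀ t, Measurable (ε' t))
    (hε'_int : ∀ t, Integrable (ε' t) μ)
    (hε'_mds : ∀ t, μ[ε' t | history Q Δ ε' t] =ᵐ[μ] 0)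
    (δ : ℝ) (hδ_nonneg : 0 ≤ δ) (hδ_lt : δ < 1 / 2)
    (cε : ℝ) (hcε : 0 < cε)
    (hε'_sq_int : ∀ t, Integrable (fun ω => ‖α t ^ δ • ε' t ω‖ ^ 2) μ)
    (hε'_sq : ∀ t, ∀ᵐ ω ∂μ,
      (μ[fun ω' => ‖α t ^ δ • ε' t ω'‖ ^ 2 | history Q Δ ε' t]) ω ≤ cε)
    -- the vanishing perturbation `ε'' t`
    (hε''_meas : ∀ t, Measurable[history Q Δ ε' (t + 1)] (ε'' t))
    (g₂ : ℝ≥0 → ℝ) (hg₂_meas : Measurable g₂) (hg₂_pos : ∀ t, 0 < g₂ t)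
    (hg₂_zero : Tendsto g₂ atTop (𝓝 0)) (hg₂_bdd : BddAbove (Set.range g₂))
    (hε'' : ∀ t : ℕ, ∀ᵐ ω ∂μ, ‖ε'' t ω‖ ≤ g₂ (t : ℝ≥0))
    -- the recursion, from an arbitrary deterministic initial condition
    (e₀ : EuclideanSpace ℝ (Fin q)) (e : ℕ → Ω → EuclideanSpace ℝ (Fin q))
    (he_zero : ∀ ω, e 0 ω = e₀)
    (he_succ : ∀ t ω, e (t + 1) ω = e t ω
      + α t • Matrix.toEuclideanLin (Q t ω + Δ t ω) (e t ω) + α t • (ε' t ω + ε'' t ω)) :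
    -- convergence in mean square
    ((∀ t, Integrable (fun ω => ‖e t ω‖ ^ 2) μ) ∧
      Tendsto (fun t => ∫ ω, ‖e t ω‖ ^ 2 ∂μ) atTop (𝓝 0)) ∧
    -- almost sure convergence under the additional conditions
    (Summable (fun t : ℕ => α (t + 1) ^ (2 * (1 - δ))) →
      Summable (fun t : ℕ => α (t + 1) * g₂ ((t + 1 : ℕ) : ℝ≥0)) →
      (∃ (u : ℕ → Ω → Matrix (Fin q) (Fin q) ℝ) (w : ℕ → Ω → EuclideanSpace ℝ (Fin q)),
        (∀ t, Measurable (u t)) ∧ (∀ t, Measurable (w t)) ∧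
        (∀ t ω, ε' t ω = Matrix.toEuclideanLin (u t ω) (w t ω)) ∧
        -- the whole sequence `w` is independent of the whole sequence `(Q, Δ, u)`
        IndepFun (fun ω t => w t ω) (fun ω t => (Q t ω, Δ t ω, u t ω)) μ ∧
        -- `w` is a martingale difference in the same sense as `ε'`: integrable, with zero
        -- conditional mean given the past
        (∀ t, Integrable (w t) μ) ∧
        (∀ t, μ[w t | history Q Δ ε' t] =ᵐ[μ] 0)) →
      ∀ᵐ ω ∂μ, Tendsto (fun t => e t ω) atTop (𝓝 0)) := by
  set γ₁ : ℕ → ℝ := fun t => g₁ (t : ℝ≥0) with hγ₁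
  set γ₂ : ℕ → ℝ := fun t => g₂ (t : ℝ≥0) with hγ₂
  have hcast : Tendsto (fun t : ℕ => (t : ℝ≥0)) atTop atTop := tendsto_natCast_atTop_atTop
  have hγ₁_zero : Tendsto γ₁ atTop (𝓝 0) := hg₁_zero.comp hcast
  have hγ₂_zero : Tendsto γ₂ atTop (𝓝 0) := hg₂_zero.comp hcast
  have hγ₂_nonneg : ∀ t, 0 ≤ γ₂ t := fun t => (hg₂_pos _).le
  have hQ : ∀ t, ∀ᵐ ω ∂μ, ‖Q t ω‖ ≤ π₁ := ae_all_iff.1 hQ_bdd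
  have hle : ∀ t, history Q Δ ε' t ≤ _ := history_le hQ_meas hΔ_meas hε'_meas
  have hε'_memLp : ∀ t, MemLp (ε' t) 2 μ := fun t => by
    have hc : α t ^ δ ≠ 0 := (Real.rpow_pos_of_pos (hα_pos t) δ).ne'
    have h1 := (memLp_two_iff_integrable_sq_norm
      ((hε'_meas t).const_smul (α t ^ δ)).aestronglyMeasurable).2 (hε'_sq_int t)
    have h2 := h1.const_smul (α t ^ δ)⁻¹
    rwa [inv_smul_smul₀ hc] at h2
  have he_hist : ∀ t, Measurable[history Q Δ ε' t] (e t) :=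
    measurable_history_state e₀ hε''_meas he_zero he_succ
  have he : ∀ t, MemLp (e t) 2 μ :=
    memLp_state e₀ hQ_meas hΔ_meas (fun t => (hε''_meas t).mono (hle _) le_rfl)
      (fun t => (he_hist t).mono (hle t) le_rfl) hQ hΔ hε'_memLp hε'' he_zero he_succ
  have he_sq : ∀ t, Integrable (fun ω => ‖e t ω‖ ^ 2) μ := fun t =>
    (memLp_two_iff_integrable_sq_norm (he t).aestronglyMeasurable).1 (he t)
  have hα_comp : ∀ κ > 0, ∀ᶠ t in atTop, ∀ j < h, |α (t + j) - α t| ≤ κ * α t :=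
    fun κ hκ => eventually_abs_sub_le_of_inv_increment hα_pos hα_zero hα_inv h hκ
  have hα_two : ∀ᶠ t in atTop, ∀ j < h, α (t + j) ≤ 2 * α t := by
    filter_upwards [hα_comp 1 one_pos] with t ht j hj
    linarith [(abs_le.1 (ht j hj)).2]
  have hmh : Tendsto (fun m : ℕ => m * h) atTop atTop := tendsto_id.atTop_mul_const' hh
  obtain ⟨C, hC, hdrift⟩ := exists_eventually_setIntegral_block_le hh hπ₁ hlam hα_pos hα_zero
    hα_comp hγ₁_zero hγ₂_nonneg hγ₂_zero hQ_meas hΔ_meas hε'_meas hQ hΔ hQ_neg hε'_memLp hε'_mds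
    hε'_sq_int hε'_sq hε'' he_hist he he_succ
  set b : ℕ → ℝ := fun m => C * ∑ j ∈ Finset.range h, (α (m * h + j) ^ (2 * (1 - δ)) * cε
    + α (m * h + j) * γ₂ (m * h + j)) with hb
  have hb_nonneg : ∀ m, 0 ≤ b m := fun m =>
    mul_nonneg hC.le (Finset.sum_nonneg fun j _ => add_nonneg
      (mul_nonneg (Real.rpow_nonneg (hα_pos _).le _) hcε.le)
      (mul_nonneg (hα_pos _).le (hγ₂_nonneg _)))
  -- the noise level in one step
  set ρ : ℕ → ℝ := fun t => C * (α t ^ (1 - 2 * δ) * cε + γ₂ t) with hρ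
  have hρ_nonneg : ∀ t, 0 ≤ ρ t := fun t =>
    mul_nonneg hC.le (add_nonneg (mul_nonneg (Real.rpow_nonneg (hα_pos _).le _) hcε.le)
      (hγ₂_nonneg _))
  have hα_rpow : Tendsto (fun t => α t ^ (1 - 2 * δ)) atTop (𝓝 0) := by
    have := hα_zero.rpow_const (p := 1 - 2 * δ) (Or.inr (by linarith))
    rwa [Real.zero_rpow (by linarith)] at this
  have hρ_zero : Tendsto ρ atTop (𝓝 0) := by
    simpa using ((hα_rpow.mul_const cε).add hγ₂_zero).const_mul C
  -- The factor α^(1-2δ) tends to zero exactly because δ < 1/2; this makes the noise contribution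
  -- negligible against α.
  have hα_split : ∀ t, α t ^ (2 * (1 - δ)) = α t * α t ^ (1 - 2 * δ) := fun t => by
    rw [← Real.rpow_one_add' (hα_pos t).le (by linarith)]
    congr 1; ring
  have hbρ : ∀ m, b m = ∑ j ∈ Finset.range h, α (m * h + j) * ρ (m * h + j) := fun m => by
    simp only [hb, hρ, Finset.mul_sum]
    refine Finset.sum_congr rfl fun j _ => ?_
    rw [hα_split]; ring
  -- mean square convergence along the block starts
  have hmean_blocks : Tendsto (fun m => ∫ ω, ‖e (m * h) ω‖ ^ 2 ∂μ) atTop (𝓝 0) := by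
    refine tendsto_zero_of_le_one_sub_mul_add (a := fun m => α (m * h)) (b := b) (half_pos hlam)
      (fun m => integral_nonneg fun ω => by positivity) (hα_zero.comp hmh)
      (tendsto_sum_multiples_atTop hα_pos hα_sum hh hα_two) (fun κ hκ => ?_) ?_
    · simp only [hbρ]
      exact eventually_sum_block_le hh hα_pos hρ_nonneg hρ_zero hα_two hκ
    -- The whole space as past event gives the unconditional means.
    · filter_upwards [hdrift] with m hm
      simpa using hm Set.univ MeasurableSet.univ
  have hnoise : ∀ t, ∫ ω, α t ^ 2 * ‖ε' t ω‖ ^ 2 ∂μ ≤ α t ^ (2 * (1 - δ)) * cε := fun t => by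
    simpa using setIntegral_step_mul_noise_le (hle t) (hα_pos t) (hε'_sq_int t) (hε'_sq t)
      MeasurableSet.univ
  obtain ⟨A, hA⟩ := hα_zero.bddAbove_range
  have hA : ∀ t, α t ≤ A := fun t => hA ⟨t, rfl⟩
  obtain ⟨G, hG⟩ := hγ₁_zero.bddAbove_range
  have hG : ∀ t, γ₁ t ≤ G := fun t => hG ⟨t, rfl⟩
  have hG0 : 0 ≤ G := (hg₁_pos 0).le.trans (by simpa [hγ₁] using hG 0)
  have hone := ae_norm_state_succ_le (μ := μ) hα_pos hA hπ₁ hG hG0 hQ hΔ hε'' he_succ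
  have hαγ : Tendsto (fun t => α t * γ₂ t) atTop (𝓝 0) := by
    simpa using hα_zero.mul hγ₂_zero
  refine ⟨⟨he_sq, ?_⟩, ?_⟩
  · refine tendsto_zero_of_tendsto_multiples hh (fun t => integral_nonneg fun ω => by positivity)
      (r := fun t => 3 * (α t ^ (2 * (1 - δ)) * cε + (α t * γ₂ t) ^ 2)) ?_
      (fun t => ?_) hmean_blocks (C := 3 * (1 + A * (π₁ + G)) ^ 2)
    · have h1 : Tendsto (fun t => α t ^ (2 * (1 - δ))) atTop (𝓝 0) := by
        simp only [hα_split]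
        simpa using hα_zero.mul hα_rpow
      simpa using ((h1.mul_const cε).add (hαγ.pow 2)).const_mul 3
    · refine (integral_norm_sq_state_succ_le (γ₂ := γ₂) (α := α) (ε' := ε')
        (C := 1 + A * (π₁ + G)) t he (hε'_memLp t)
        (hone.mono fun ω hω => hω t)).trans ?_
      gcongr
      exact hnoise t
  · intro ha_sum hb_sum _
    -- The hypotheses sum from time 1; adding the single term at time 0 does not affect summability.
    have ha_sum : Summable fun t => α t ^ (2 * (1 - δ)) := (summable_nat_add_iff 1).1 ha_sum
    have hb_sum : Summable fun t => α t * γ₂ t :=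
      (summable_nat_add_iff (f := fun t => α t * γ₂ t) 1).1 hb_sum
    have hbsum : Summable b :=
      (Summable.sum_blocks ((ha_sum.mul_right cε).add hb_sum) hh).mul_left C
    obtain ⟨M, hM⟩ := eventually_atTop.1 hdrift
    -- The drift inequality holds only from block M on, so the filtration starts there.
    let 𝒢 : Filtration ℕ ‹MeasurableSpace Ω› :=
      ⟨fun m => history Q Δ ε' ((m + M) * h),
        fun m n hmn => history_mono (Nat.mul_le_mul_right h (by omega)), fun m => hle _⟩
    have hblocks : ∀ᵐ ω ∂μ, Tendsto (fun m => ‖e ((m + M) * h) ω‖ ^ 2) atTop (𝓝 0) := by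
      refine ae_tendsto_zero_of_almost_supermartingale (𝒢 := 𝒢) (b := fun m => b (m + M))
        (fun m ω => by positivity)
        (fun m => ((he_hist _).stronglyMeasurable.norm.pow 2)) (fun m => he_sq _)
        (fun m => hb_nonneg _) ((summable_nat_add_iff M).2 hbsum) (fun m s hs => ?_)
        ((tendsto_add_atTop_iff_nat M).2 hmean_blocks)
      have h1 := hM (m + M) (Nat.le_add_left _ _) s hs
      rw [show m + 1 + M = m + M + 1 by ring]
      refine h1.trans ?_
      have h2 : 0 ≤ lam / 2 * α ((m + M) * h) * ∫ ω in s, ‖e ((m + M) * h) ω‖ ^ 2 ∂μ :=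
        mul_nonneg (mul_nonneg (half_pos hlam).le (hα_pos _).le)
          (integral_nonneg fun ω => by positivity)
      linarith
    -- This makes the noise increments α ‖ε'‖ vanish along almost every path, as required between
    -- block starts.
    have hnoise_lim : ∀ᵐ ω ∂μ, Tendsto (fun t => α t ^ 2 * ‖ε' t ω‖ ^ 2) atTop (𝓝 0) :=
      ae_tendsto_zero_of_summable_integral (fun t ω => by positivity)
        (fun t => ((memLp_two_iff_integrable_sq_norm
          (hε'_memLp t).aestronglyMeasurable).1 (hε'_memLp t)).const_mul _)
        (Summable.of_nonneg_of_le (fun t => integral_nonneg fun ω => by positivity) hnoise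
          (ha_sum.mul_right cε))
    filter_upwards [hblocks, hnoise_lim, hone] with ω h1 h2 h3
    rw [tendsto_zero_iff_norm_tendsto_zero]
    have h4 : Tendsto (fun t => α t * ‖ε' t ω‖) atTop (𝓝 0) := by
      have := h2.sqrt
      rw [Real.sqrt_zero] at this
      refine this.congr fun t => ?_
      rw [← mul_pow, Real.sqrt_sq (mul_nonneg (hα_pos t).le (norm_nonneg _))]
    have h5 : Tendsto (fun m => ‖e (m * h) ω‖) atTop (𝓝 0) := by
      rw [← tendsto_add_atTop_iff_nat M]
      have := h1.sqrt
      rw [Real.sqrt_zero] at this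
      exact this.congr fun m => Real.sqrt_sq (norm_nonneg _)
    exact tendsto_zero_of_tendsto_multiples hh (fun t => norm_nonneg _)
      (by simpa using h4.add hαγ) h3 h5
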